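/- **Setting.** Let $A\in\mathbb R^{n\times p}$, $\mathcal X\subseteq\mathbb R^p$ Borel, and for $\tau>0$ let $\mathcal Y=\mathcal Y_\tau\subseteq\mathbb R^n$ be Borel. Norms are Euclidean norms of vectors and spectral norms of matrices; $B(z,R)$ is the closed ball. Given $x\in\mathcal X$, the data have density $C_{y,\tau}\exp\{-\tilde f_y(Ax)/\tau\}$, $y\in\mathcal Y$, with respect to Lebesgue or counting measure. The prior density is proportional to $\exp(-g(x)/\gamma^2)$ on $\mathcal X$ (possibly improper), with $\nu=\nu(\tau)=\tau/\gamma^2>0$. The functions involved are measurable. There is a differentiable injective link $G:A\mathcal X\to\mathbb R^n$ such that for every $\mu_0\in A\mathcal X$ the function $\tilde f_{G(\mu_0)}$ has its unique minimum over $A\mathcal X$ at $\mu_0$. Let $x_{\rm true}\in\mathcal X$ and $y^*=G(Ax_{\rm true})$. The data $Y=Y_\tau$ have the above distribution with $x=x_{\rm true}$, and $Y\to y^*$ in probability as $\tau\to0$. Put $h_y(x)=\tilde f_y(Ax)+\nu g(x)$. For all small $\tau$ and all $y\in\mathcal Y$, $\int_{\mathcal X}e^{-h_y/\tau}dx<\infty$,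 and $\mu_{\rm post}$ is the probability measure on $\mathcal X$ with density proportional to $e^{-h_Y(x)/\tau}$. Let $x^\star$ be the unique minimiser of $g$ over $\{x\in\mathcal X: Ax=Ax_{\rm true}\}$, and assume that it is an interior point of $\mathcal X$. The Ky Fan distance is $\rho_K(\xi_1,\xi_2)=\inf\{\varepsilon>0:\mathbb P(d(\xi_1,\xi_2)>\varepsilon)<\varepsilon\}$, with $d$ the Euclidean metric for data and the Prokhorov metric for random probability measures. Write $r=\rho_K(Y,y^*)$ and $\mathcal Y_{\rm loc}=\{y\in\mathcal Y:\|y-y^*\|\le r\}$. **Assumptions** (for all small $\tau$; $\delta=\delta(\tau)>0$). *Smoothness.* For $x\in B(x^\star,\delta)$ and $y\in\mathcal Y_{\rm loc}$, $\tilde f_y$ is $C^2$ near $Ax$ and $g$ is $C^2$ near $x$; $\tilde f_{y^*}$ is $C^2$ near $Ax^\star$. There are positive semidefinite $C_f\in\mathbb R^{n\times n}$, $C_g\in\mathbb R^{p\times p}$, which may depend on $\tau$ but stay bounded as $\tau\to0$, such that for such $x,y$ and all $v$: $|v^T(\nabla^2\tilde f_y(Ax)-\nabla^2\tilde f_y(Ax^\star))v|\le\delta\|A\|v^TC_fv$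 and $|v^T(\nabla^2g(x)-\nabla^2g(x^\star))v|\le\delta v^TC_gv$. *Convergence in $y$.* There are fixed positive semidefinite $M_{f1},M_{f2}\in\mathbb R^{n\times n}$ such that for all $y\in\mathcal Y_{\rm loc}$, $V\in\mathbb R^{p\times n}$, $v\in\mathbb R^n$: $\|V(\nabla\tilde f_y(Ax^\star)-\nabla\tilde f_{y^*}(Ax^\star))\|\le\|VM_{f1}(y-y^*)\|$ and $|v^T(\nabla^2\tilde f_y(Ax^\star)-\nabla^2\tilde f_{y^*}(Ax^\star))v|\le v^TM_{f2}^{1/2}\,{\rm diag}(|y_j-y^*_j|)\,M_{f2}^{1/2}v$. *Conditions on $\delta$.* As $\tau\to0$: $\delta\to0$, $\delta/\sqrt\tau\to\infty$, $(r+\nu)/\delta\to0$, $\delta(r+\nu)^2/\tau\to0$, and, if $A$ is not injective, $\delta/\gamma\to\infty$. Moreover $\bar\Delta_0\to0$, where $\bar\Delta_0=\sup_{y\in\mathcal Y_{\rm loc}}\Delta_0(y)$ and $$\Delta_0(y)=\frac{\int_{\mathcal X\setminus B(x^\star,\delta)}e^{-[h_y(x)-h_y(x^\star)]/\tau}dx}{\int_{B(x^\star,\delta)}e^{-[h_y(x)-h_y(x^\star)]/\tau}dx}.$$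 *Nondegeneracy.* With $V=\nabla^2\tilde f_{y^*}(Ax^\star)$, $v^TVv>0$ for all nonzero $v$ in the range of $A$, and $H_\nu=A^TVA+\nu\nabla^2g(x^\star)$ is positive definite for all small $\tau$. **Notation.** $D=\|A\|A^TC_fA+\nu C_g$, $\tilde\lambda=\delta\|H_\nu^{-1}D\|+r\|H_\nu^{-1}A^TM_{f2}A\|$, $\bar c_1=\|H_\nu^{-1}A^TM_{f1}\|/(1-\tilde\lambda)$, $\bar c_2=\|H_\nu^{-1}\nabla g(x^\star)\|/(1-\tilde\lambda)$, $R^\star=\sqrt{\lambda_{\min}(H_\nu)/\tau}\,\sqrt{1-\tilde\lambda}\,(\delta-\bar c_1r-\bar c_2\nu)$, $\Phi$ the standard Gaussian measure on $\mathbb R^p$, and $$\Delta_{\star,K}=\frac{\exp\{\delta\|D\|(\bar c_1r+\bar c_2\nu)^2/\tau\}}{\Phi(B(0,R^\star))}\Big(\frac{1+\tilde\lambda}{1-\tilde\lambda}\Big)^{p/2}-1+\bar\Delta_0+\tilde\lambda.$$ **Theorem.** There are $\Delta_0=\Delta_0(\tau)=\bar\Delta_0\,(1+o(1))$ as $\tau\to0$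 and $\tau_0>0$ such that for all $\tau\in(0,\tau_0]$: $\tilde\lambda<1$, $4\tau\,{\rm tr}(H_\nu^{-1})<1$, and $$\rho_K(\mu_{\rm post},\delta_{x^\star})\le\max\Big\{2r,\ \frac{\Delta_0}{1+\Delta_0},\ \bar c_1r+\bar c_2\nu+\sqrt{-4\tau\,{\rm tr}(H_\nu^{-1})\log(4\tau\,{\rm tr}(H_\nu^{-1}))}\,(1+\Delta_{\star,K})\Big\}.$$ Moreover $\Delta_{\star,K}\to0$ as $\tau\to0$. -/

import Mathlib

open Filter Topology MeasureTheory ProbabilityTheory Set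

noncomputable section

/-- Euclidean space of dimension `d`, with the `ℓ²` norm. -/
abbrev Euc (d : ℕ) : Type := EuclideanSpace ℝ (Fin d)

/-- The Ky Fan distance `inf {ε > 0 : P (d (ξ₁, ξ₂) > ε) < ε}` of two random elements of a space
with distance function `d`. -/
def kyFan {Ω W : Type*} [MeasurableSpace Ω] (P : Measure Ω) (d : W → W → ℝ) (ξ₁ ξ₂ : Ω → W) : ℝ :=
  sInf {ε : ℝ | 0 < ε ∧ P {ω | ε < d (ξ₁ ω) (ξ₂ ω)} < ENNReal.ofReal ε}

/-- The matrix of second derivatives of `φ` at `x`, as an operator: the derivative of the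
gradient. -/
def hess {d : ℕ} (φ : Euc d → ℝ) (x : Euc d) : Euc d →L[ℝ] Euc d :=
  fderiv ℝ (gradient φ) x

/-- The data of a generalised linear inverse problem with a prior. `f y η` is the rescaled
negative log-likelihood `f̃_y(η)`, `C τ y` the normalising factor `C_{y,τ}`, `G` the link function,
`g` the negative log prior density and `nu τ = τ / γ²`. The sample space may depend on `τ`. -/
structure GLIP (n p : ℕ) where
  X : Set (Euc p)
  Ysp : ℝ → Set (Euc n)
  base : Measure (Euc n)
  A : Euc p →L[ℝ] Euc n
  G : Euc n → Euc n
  f : Euc n → Euc n → ℝ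
  C : ℝ → Euc n → ℝ
  g : Euc p → ℝ
  nu : ℝ → ℝ
  xtrue : Euc p

namespace GLIP

variable {n p : ℕ} (M : GLIP n p)

/-- The exact data `y* = G (A x_true)`. -/
def yexact : Euc n := M.G (M.A M.xtrue)

/-- The function `h_y(x) = f̃_y(Ax) + ν g(x)`. -/
def h (τ : ℝ) (y : Euc n) (x : Euc p) : ℝ := M.f y (M.A x) + M.nu τ * M.g x

/-- The distribution of the data given `x`: density `C_{y,τ} exp(-f̃_y(Ax)/τ)` on the sample
space, with respect to the base measure. -/
def likelihood (τ : ℝ) (x : Euc p) : Measure (Euc n) :=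
  (M.base.restrict (M.Ysp τ)).withDensity
    fun y => ENNReal.ofReal (M.C τ y * Real.exp (-(M.f y (M.A x)) / τ))

/-- The posterior distribution given `y`: the probability measure on `X` with Lebesgue density
proportional to `exp(-h_y(x)/τ)`. -/
def posterior (τ : ℝ) (y : Euc n) : Measure (Euc p) :=
  (volume.restrict M.X).tilted fun x => -(M.h τ y x) / τ

/-- The prior scale `γ`, where `γ² = τ/ν`. -/
def gam (τ : ℝ) : ℝ := Real.sqrt (τ / M.nu τ)

/-- The assumptions on the Bayesian model: a link function that is differentiable and injective on
`A X`, a likelihood that is a probability density with respect to Lebesgue or counting measure, and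
identifiability: for exact data `G μ₀` the function `f̃` has its unique minimum over `A X` at
`μ₀`. -/
structure IsModel : Prop where
  measurableSet_X : MeasurableSet M.X
  measurableSet_Ysp : ∀ τ, MeasurableSet (M.Ysp τ)
  base_eq : M.base = volume ∨ M.base = Measure.count
  measurable_C : ∀ τ, Measurable (M.C τ)
  C_nonneg : ∀ τ, 0 < τ → ∀ y ∈ M.Ysp τ, 0 ≤ M.C τ y
  measurable_f : Measurable fun q : Euc n × M.X => M.f q.1 (M.A q.2)
  measurable_g : Measurable fun x : M.X => M.g x
  nu_pos : ∀ τ, 0 < τ → 0 < M.nu τ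
  xtrue_mem : M.xtrue ∈ M.X
  differentiable_link : DifferentiableOn ℝ M.G (M.A '' M.X)
  injective_link : InjOn M.G (M.A '' M.X)
  normalised : ∀ τ, 0 < τ → ∀ x ∈ M.X, IsProbabilityMeasure (M.likelihood τ x)
  identifiable : ∀ μ₀ ∈ M.A '' M.X, ∀ η ∈ M.A '' M.X, η ≠ μ₀ →
    M.f (M.G μ₀) μ₀ < M.f (M.G μ₀) η

/-- `xs` is the unique minimiser of `g` over the points `x ∈ X` with `A x = A x_true`. -/
def IsLimitPoint (xs : Euc p) : Prop :=
  xs ∈ M.X ∧ M.A xs = M.A M.xtrue ∧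
    ∀ x ∈ M.X, M.A x = M.A M.xtrue → x ≠ xs → M.g xs < M.g x

/-- The posterior distributions are proper for all small `τ`. -/
def ProperPosterior : Prop :=
  ∀ᶠ τ in 𝓝[>] (0 : ℝ), ∀ y ∈ M.Ysp τ,
    IntegrableOn (fun x => Real.exp (-(M.h τ y x) / τ)) M.X

/-- The set of points of the sample space within distance `r` of the exact data; it is used with
`r` the Ky Fan distance between the data and the exact data. -/
def yLoc (τ r : ℝ) : Set (Euc n) := {y | y ∈ M.Ysp τ ∧ ‖y - M.yexact‖ ≤ r}

/-- The posterior mass ratio `Δ₀` of the outside and the inside of the ball `B(xs, δ)`. -/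
def Delta0 (xs : Euc p) (δ τ : ℝ) (y : Euc n) : ℝ :=
  (∫ x in M.X \ Metric.closedBall xs δ, Real.exp (-(M.h τ y x - M.h τ y xs) / τ)) /
    ∫ x in Metric.closedBall xs δ, Real.exp (-(M.h τ y x - M.h τ y xs) / τ)

/-- The supremum of `Δ₀` over the data in `yLoc`. -/
def Delta0Sup (xs : Euc p) (δ τ r : ℝ) : ℝ :=
  ⨆ y : M.yLoc τ r, M.Delta0 xs δ τ y

end GLIP

/-- The radius `δ` and the matrices of the smoothness and convergence assumptions, as functions of
`τ` where they may depend on `δ`. `Mf2sqrt` is the square root of the matrix `M_{f,2}`. -/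
structure LocalData (n p : ℕ) where
  δ : ℝ → ℝ
  Cf : ℝ → Euc n →L[ℝ] Euc n
  Cg : ℝ → Euc p →L[ℝ] Euc p
  Mf1 : Euc n →L[ℝ] Euc n
  Mf2sqrt : Euc n →L[ℝ] Euc n

namespace LocalData

variable {n p : ℕ} (L : LocalData n p)

/-- The matrix `M_{f,2}`. -/
def Mf2 : Euc n →L[ℝ] Euc n := L.Mf2sqrt ∘L L.Mf2sqrt

/-- The matrix `diag(|y_1 - z_1|, …, |y_n - z_n|)`. -/
def diagAbs (y z : Euc n) : Euc n →L[ℝ] Euc n :=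
  Matrix.toEuclideanCLM (n := Fin n) (𝕜 := ℝ) (Matrix.diagonal fun j => |y j - z j|)

/-- Smoothness in `x`, where `r τ` is the Ky Fan distance between the data and the exact data. -/
structure SmoothInX (M : GLIP n p) (xs : Euc p) (r : ℝ → ℝ) : Prop where
  contDiff_f : ∀ᶠ τ in 𝓝[>] (0 : ℝ), ∀ y ∈ M.yLoc τ (r τ),
    ∀ x ∈ Metric.closedBall xs (L.δ τ), ContDiffAt ℝ 2 (M.f y) (M.A x)
  contDiff_f_exact : ContDiffAt ℝ 2 (M.f M.yexact) (M.A xs)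
  contDiff_g : ∀ᶠ τ in 𝓝[>] (0 : ℝ), ∀ x ∈ Metric.closedBall xs (L.δ τ), ContDiffAt ℝ 2 M.g x
  Cf_pos : ∀ τ, (L.Cf τ).IsPositive
  Cg_pos : ∀ τ, (L.Cg τ).IsPositive
  bounded : ∃ K : ℝ, ∀ᶠ τ in 𝓝[>] (0 : ℝ), ‖L.Cf τ‖ ≤ K ∧ ‖L.Cg τ‖ ≤ K
  hess_f : ∀ᶠ τ in 𝓝[>] (0 : ℝ), ∀ y ∈ M.yLoc τ (r τ),
    ∀ x ∈ Metric.closedBall xs (L.δ τ), ∀ v : Euc n,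
      |inner ℝ v ((hess (M.f y) (M.A x) - hess (M.f y) (M.A xs)) v)|
        ≤ L.δ τ * ‖M.A‖ * inner ℝ v (L.Cf τ v)
  hess_g : ∀ᶠ τ in 𝓝[>] (0 : ℝ), ∀ x ∈ Metric.closedBall xs (L.δ τ), ∀ v : Euc p,
      |inner ℝ v ((hess M.g x - hess M.g xs) v)| ≤ L.δ τ * inner ℝ v (L.Cg τ v)

/-- Convergence of the derivatives of the log-likelihood in `y`. -/
structure ConvergesInY (M : GLIP n p) (xs : Euc p) (r : ℝ → ℝ) : Prop where
  Mf1_pos : L.Mf1.IsPositive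
  Mf2sqrt_pos : L.Mf2sqrt.IsPositive
  grad : ∀ᶠ τ in 𝓝[>] (0 : ℝ), ∀ y ∈ M.yLoc τ (r τ), ∀ V : Euc n →L[ℝ] Euc p,
    ‖V (gradient (M.f y) (M.A xs) - gradient (M.f M.yexact) (M.A xs))‖
      ≤ ‖V (L.Mf1 (y - M.yexact))‖
  hess_f : ∀ᶠ τ in 𝓝[>] (0 : ℝ), ∀ y ∈ M.yLoc τ (r τ), ∀ v : Euc n,
    |inner ℝ v ((hess (M.f y) (M.A xs) - hess (M.f M.yexact) (M.A xs)) v)|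
      ≤ inner ℝ v (L.Mf2sqrt (diagAbs y M.yexact (L.Mf2sqrt v)))

/-- The assumptions on `δ`. -/
structure DeltaAssumptions (M : GLIP n p) (xs : Euc p) (r : ℝ → ℝ) : Prop where
  tendsto_zero : Tendsto L.δ (𝓝[>] 0) (𝓝 0)
  div_sqrt : Tendsto (fun τ => L.δ τ / Real.sqrt τ) (𝓝[>] 0) atTop
  dominates : Tendsto (fun τ => (r τ + M.nu τ) / L.δ τ) (𝓝[>] 0) (𝓝 0)
  localQuad : Tendsto (fun τ => L.δ τ * (r τ + M.nu τ) ^ 2 / τ) (𝓝[>] 0) (𝓝 0)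
  div_gam : ¬ Function.Injective M.A → Tendsto (fun τ => L.δ τ / M.gam τ) (𝓝[>] 0) atTop
  Delta0_small : ∀ ε : ℝ, 0 < ε → ∀ᶠ τ in 𝓝[>] (0 : ℝ), ∀ y ∈ M.yLoc τ (r τ),
    M.Delta0 xs (L.δ τ) τ y ≤ ε

/-! The constants of the bound. In them `r` is the Ky Fan distance between the data and the exact
data at the given `τ`. -/

variable (M : GLIP n p) (xs : Euc p)

/-- `H_ν = Aᵀ V A + ν ∇²g(xs)`, where `V` is the Hessian of `f̃` at the exact data. -/
def Hnu (τ : ℝ) : Euc p →L[ℝ] Euc p :=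
  M.A.adjoint ∘L hess (M.f M.yexact) (M.A xs) ∘L M.A + M.nu τ • hess M.g xs

/-- The inverse of `H_ν`. -/
def HnuInv (τ : ℝ) : Euc p →L[ℝ] Euc p := Ring.inverse (Hnu M xs τ)

/-- The trace of the inverse of `H_ν`. -/
def trHnuInv (τ : ℝ) : ℝ := LinearMap.trace ℝ (Euc p) (HnuInv M xs τ).toLinearMap

/-- `D = Aᵀ C_f A ‖A‖ + ν C_g`. -/
def D (τ : ℝ) : Euc p →L[ℝ] Euc p :=
  ‖M.A‖ • (M.A.adjoint ∘L L.Cf τ ∘L M.A) + M.nu τ • L.Cg τ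

/-- `λ̃ = δ ‖H_ν⁻¹ D‖ + r ‖H_ν⁻¹ Aᵀ M_{f,2} A‖`. -/
def lamTilde (τ r : ℝ) : ℝ :=
  L.δ τ * ‖HnuInv M xs τ ∘L L.D M τ‖
    + r * ‖HnuInv M xs τ ∘L M.A.adjoint ∘L L.Mf2 ∘L M.A‖

/-- `c̄₁ = ‖H_ν⁻¹ Aᵀ M_{f,1}‖ / (1 - λ̃)`. -/
def cbar1 (τ r : ℝ) : ℝ :=
  ‖HnuInv M xs τ ∘L M.A.adjoint ∘L L.Mf1‖ / (1 - L.lamTilde M xs τ r)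

/-- `c̄₂ = ‖H_ν⁻¹ ∇g(xs)‖ / (1 - λ̃)`. -/
def cbar2 (τ r : ℝ) : ℝ :=
  ‖HnuInv M xs τ (gradient M.g xs)‖ / (1 - L.lamTilde M xs τ r)

/-- The bias bound `c̄₁ r + c̄₂ ν`. -/
def bias (τ r : ℝ) : ℝ := L.cbar1 M xs τ r * r + L.cbar2 M xs τ r * M.nu τ

/-- The smallest eigenvalue of a positive definite matrix, `min_{‖v‖ = 1} ‖T v‖`. -/
def lamMin (T : Euc p →L[ℝ] Euc p) : ℝ := sInf ((fun v => ‖T v‖) '' Metric.sphere (0 : Euc p) 1)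

/-- `R⋆ = (λ_min(H_ν)/τ)^{1/2} (1 - λ̃)^{1/2} (δ - c̄₁ r - c̄₂ ν)`. -/
def Rstar (τ r : ℝ) : ℝ :=
  Real.sqrt (lamMin (Hnu M xs τ) / τ) * Real.sqrt (1 - L.lamTilde M xs τ r)
    * (L.δ τ - L.bias M xs τ r)

/-- The standard Gaussian measure of the ball `B(0, R)` in dimension `p`. -/
def gaussBall (p : ℕ) (R : ℝ) : ℝ :=
  (2 * Real.pi) ^ (-(p : ℝ) / 2) *
    ∫ x in Metric.closedBall (0 : Euc p) R, Real.exp (-‖x‖ ^ 2 / 2)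

/-- The error term `Δ_{⋆,K}`. -/
def DeltaStarK (τ r : ℝ) : ℝ :=
  Real.exp (L.δ τ * ‖L.D M τ‖ * L.bias M xs τ r ^ 2 / τ) / gaussBall p (L.Rstar M xs τ r)
      * ((1 + L.lamTilde M xs τ r) / (1 - L.lamTilde M xs τ r)) ^ ((p : ℝ) / 2) - 1
    + M.Delta0Sup xs (L.δ τ) τ r + L.lamTilde M xs τ r

end LocalData

end

/-! The posterior is estimated for each fixed `y ∈ yLoc`; randomness enters only at the end. Since
`‖Y - y*‖ > r` has probability at most `r` (`measure_kyFan_lt_le`), it suffices to bound the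
Prokhorov distance from the posterior to the Dirac mass for these `y`, and for this it is enough
that the posterior mass outside `B(xs, ε)` is at most `ε` (`levyProkhorovDist_dirac_le`).

Fix such a `y`. As quadratic forms, `δ D + r Aᵀ M_{f,2} A ≤ λ̃ H_ν`, so on `B(xs, δ)` Taylor's
formula squeezes `h_y` between two quadratics with the same gradient at `xs` and Hessians `(1 ± λ̃)
H_ν`. The Newton step `H_ν⁻¹ ∇h_y(xs)` has norm at most `(1 - λ̃)` times the bias, so both Gaussians
are centred within the bias of `xs`. Let `κ = 4 τ tr(H_ν⁻¹)` and `s = √(-κ log κ)`. Comparing the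
two Gaussians (`setIntegral_ball_tail_le`) shows that the fraction `q` of the mass of the ball
beyond distance `bias + s (1 + Δ_{⋆,K})` is at most a constant times `κ`; here `Δ_{⋆,K} ≥ λ̃`
compensates the loss of the factor `1 - λ̃`. The mass outside the ball enters through `Δ₀(y)`, and
the whole tail is at most `1 - (1 - q) / (1 + Δ₀(y))`. As `q = O(κ) = o(s)`, it is absorbed either
by the third term of the maximum or by a factor `1 + o(1)` on the supremum of `Δ₀`
(`one_sub_div_le_max`).

The asymptotics need care because `H_ν` may degenerate as `ν → 0`. It is a convex combination of a
fixed positive definite operator and `Q = Aᵀ V A`, which makes `H_ν⁻¹` bounded on the range of `Q`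
and `ν H_ν⁻¹` bounded everywhere. The range of `Q` contains that of `Aᵀ` and, by optimality of `xs`,
also `∇g(xs)`. Hence `λ̃ = O(δ + r)`, the bias is `O(r + ν)`, and `Δ_{⋆,K} → 0`. -/

noncomputable section

/-! ### Positive operators and generalised Rayleigh quotients. -/

section LinearAlgebra

variable {E : Type*} [NormedAddCommGroup E] [InnerProductSpace ℝ E]

/-- The quotient `a / b` is constant on rays, so it attains its maximum on the compact unit sphere.
The first alternative is the trivial space, where the sphere is empty. -/
theorem exists_pos_mul_le_of_homogeneous [FiniteDimensional ℝ E] {a b : E → ℝ}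
    (ha : Continuous a) (hb : Continuous b)
    (ha2 : ∀ (c : ℝ) v, a (c • v) = c ^ 2 * a v) (hb2 : ∀ (c : ℝ) v, b (c • v) = c ^ 2 * b v)
    (hb0 : ∀ v, v ≠ 0 → 0 < b v) :
    (∀ v : E, v = 0) ∨ ∃ v₀, v₀ ≠ 0 ∧ ∀ v, a v ≤ a v₀ / b v₀ * b v := by
  rcases subsingleton_or_nontrivial E with h | h
  · exact Or.inl fun v => Subsingleton.elim _ _
  right
  have hne : ∀ v ∈ Metric.sphere (0 : E) 1, v ≠ 0 := fun v hv h0 => by simp [h0] at hv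
  obtain ⟨v₀, hv₀, hmax⟩ := (isCompact_sphere (0 : E) 1).exists_isMaxOn
    (NormedSpace.sphere_nonempty.2 zero_le_one) (f := fun v => a v / b v)
    (ha.continuousOn.div hb.continuousOn fun v hv => (hb0 v (hne v hv)).ne')
  refine ⟨v₀, hne v₀ hv₀, fun v => ?_⟩
  rcases eq_or_ne v 0 with rfl | hv
  · have h1 := ha2 0 (0 : E)
    have h2 := hb2 0 (0 : E)
    simp only [zero_smul] at h1 h2
    rw [h1, h2]; simp
  have hn : 0 < ‖v‖ := norm_pos_iff.2 hv
  have hmem : ‖v‖⁻¹ • v ∈ Metric.sphere (0 : E) 1 := by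
    simp [norm_smul, hn.ne']
  have h := hmax hmem
  simp only [ha2, hb2, mem_ofPred_eq] at h
  rw [mul_div_mul_left _ _ (by positivity), div_le_iff₀ (hb0 v hv)] at h
  exact h

theorem ContinuousLinearMap.exists_pos_mul_sq_le_inner [FiniteDimensional ℝ E] {T : E →L[ℝ] E}
    (hT : ∀ v, v ≠ 0 → 0 < inner ℝ v (T v)) :
    ∃ c : ℝ, 0 < c ∧ ∀ v, c * ‖v‖ ^ 2 ≤ inner ℝ v (T v) := by
  rcases exists_pos_mul_le_of_homogeneous (a := fun v : E => ‖v‖ ^ 2)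
    (b := fun v => inner ℝ v (T v)) (by fun_prop) (by fun_prop)
    (fun c v => by simp [norm_smul, mul_pow]) (fun c v => by
      simp [real_inner_smul_left, real_inner_smul_right]; ring) hT with h | ⟨v₀, hv₀, h⟩
  · exact ⟨1, one_pos, fun v => by simp [h v]⟩
  · have h1 : 0 < ‖v₀‖ ^ 2 := by positivity
    have h2 := hT v₀ hv₀
    refine ⟨inner ℝ v₀ (T v₀) / ‖v₀‖ ^ 2, by positivity, fun v => ?_⟩
    have := h v
    rw [div_mul_eq_mul_div, le_div_iff₀ h2] at this
    rw [div_mul_eq_mul_div, div_le_iff₀ h1]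
    linarith

/-- The quadratic form is minimal at `v`; if `T v ≠ 0`, a small step along `-T v` would make it
negative. -/
theorem ContinuousLinearMap.apply_eq_zero_of_inner_self_eq_zero {T : E →L[ℝ] E}
    (hs : T.IsSymmetric) (h0 : ∀ v, 0 ≤ inner ℝ v (T v)) {v : E} (hv : inner ℝ v (T v) = 0) :
    T v = 0 := by
  by_contra hne
  have hTT : 0 < inner ℝ (T v) (T v) := real_inner_self_pos.2 hne
  have key : ∀ t : ℝ, 0 ≤ 2 * t * inner ℝ (T v) (T v) + t ^ 2 * inner ℝ (T v) (T (T v)) := by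
    intro t
    have h := h0 (v + t • T v)
    have hsym : inner ℝ v (T (T v)) = inner ℝ (T v) (T v) := (hs v (T v)).symm
    simp only [map_add, map_smul, inner_add_left, inner_add_right, real_inner_smul_left,
      real_inner_smul_right, hv, hsym] at h
    linarith
  set α := inner ℝ (T v) (T v)
  set β := inner ℝ (T v) (T (T v))
  have hβ : 0 ≤ β := h0 _
  -- The step `α / β` would be optimal; `β + 1` avoids division by zero and still gives a negative
  -- value.
  have h := key (-(α / (β + 1)))
  have e : 2 * (-(α / (β + 1))) * α + (-(α / (β + 1))) ^ 2 * β
      = -(α ^ 2 * (β + 2) / (β + 1) ^ 2) := by field_simp; ring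
  rw [e] at h
  have : 0 < α ^ 2 * (β + 2) / (β + 1) ^ 2 := by positivity
  linarith

/-- The best constant `μ` is the largest generalised eigenvalue of the pair `(B, H)`. At a maximiser
`v₀` the positive semidefinite form of `μ H - B` vanishes, so `B v₀ = μ H v₀`. Thus `μ` is an
eigenvalue of `K ∘L B = H⁻¹ B` and is bounded by its norm, although this product need not be
symmetric. -/
theorem inner_le_norm_inverse_comp_mul_inner [FiniteDimensional ℝ E] {H B K : E →L[ℝ] E}
    (hHs : H.IsSymmetric)
    (hH : ∀ v, v ≠ 0 → 0 < inner ℝ v (H v)) (hB : B.IsPositive)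
    (hK : ∀ v, K (H v) = v) (v : E) :
    inner ℝ v (B v) ≤ ‖K ∘L B‖ * inner ℝ v (H v) := by
  rcases exists_pos_mul_le_of_homogeneous (a := fun v => inner ℝ v (B v))
    (b := fun v => inner ℝ v (H v)) (by fun_prop) (by fun_prop)
    (fun c v => by simp [real_inner_smul_left, real_inner_smul_right]; ring) (fun c v => by
      simp [real_inner_smul_left, real_inner_smul_right]; ring) hH with h | ⟨v₀, hv₀, h⟩
  · simp [h v]
  set μ := inner ℝ v₀ (B v₀) / inner ℝ v₀ (H v₀) with hμ
  have h2 := hH v₀ hv₀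
  have hμ0 : 0 ≤ μ := div_nonneg (hB.inner_nonneg_right v₀) h2.le
  have hz : (μ • H - B) v₀ = 0 := by
    apply ContinuousLinearMap.apply_eq_zero_of_inner_self_eq_zero
    · intro x y
      have h1 := hHs x y
      have h2 := hB.isSymmetric x y
      simp only [ContinuousLinearMap.coe_coe] at h1 h2
      simp [inner_sub_left, inner_sub_right, real_inner_smul_left, real_inner_smul_right, h1, h2]
    · intro v
      have := h v
      simp only [sub_apply, smul_apply, inner_sub_right,
        real_inner_smul_right]
      linarith
    · simp only [sub_apply, smul_apply, inner_sub_right,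
        real_inner_smul_right]
      rw [hμ, div_mul_cancel₀ _ h2.ne', sub_self]
  have hB0 : B v₀ = μ • H v₀ := by
    rw [sub_apply, smul_apply, sub_eq_zero] at hz
    exact hz.symm
  have hle : μ ≤ ‖K ∘L B‖ := by
    have := (K ∘L B).le_opNorm v₀
    rw [ContinuousLinearMap.comp_apply, hB0, map_smul, hK, norm_smul, Real.norm_of_nonneg hμ0]
      at this
    exact le_of_mul_le_mul_right this (norm_pos_iff.2 hv₀)
  refine (h v).trans (mul_le_mul_of_nonneg_right hle ?_)
  rcases eq_or_ne v 0 with rfl | hv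
  · simp
  · exact (hH v hv).le

/-- In an eigenbasis of `H`, each inverse eigenvalue is at most the sum of all of them, which is the
trace of `H⁻¹`. This is how the trace enters the Gaussian tail. -/
theorem sq_norm_le_trace_mul_inner [FiniteDimensional ℝ E] {H K : E →L[ℝ] E} (hHs : H.IsSymmetric)
    (hH : ∀ v, v ≠ 0 → 0 < inner ℝ v (H v)) (hK : ∀ v, K (H v) = v) (v : E) :
    ‖v‖ ^ 2 ≤ LinearMap.trace ℝ E K.toLinearMap * inner ℝ v (H v) := by
  set e := hHs.eigenvectorBasis rfl
  set l := hHs.eigenvalues rfl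
  have hle : ∀ i, H (e i) = l i • e i := fun i => by
    exact hHs.apply_eigenvectorBasis rfl i
  have hlpos : ∀ i, 0 < l i := fun i => by
    have := hH (e i) (e.orthonormal.ne_zero i)
    rw [hle, real_inner_smul_right, real_inner_self_eq_norm_sq, e.orthonormal.1 i] at this
    simpa using this
  have hKe : ∀ i, K (e i) = (l i)⁻¹ • e i := fun i => by
    have := hK (e i)
    rw [hle, map_smul] at this
    rw [eq_inv_smul_iff₀ (hlpos i).ne', this]
  have htr : LinearMap.trace ℝ E K.toLinearMap = ∑ i, (l i)⁻¹ := by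
    rw [LinearMap.trace_eq_sum_inner _ e]
    refine Finset.sum_congr rfl fun i _ => ?_
    simp [hKe, real_inner_smul_right]
  have hin : inner ℝ v (H v) = ∑ i, l i * inner ℝ (e i) v ^ 2 := by
    rw [← e.sum_inner_mul_inner v (H v)]
    refine Finset.sum_congr rfl fun i _ => ?_
    have : inner ℝ (e i) (H v) = inner ℝ (H (e i)) v := (hHs (e i) v).symm
    rw [this, hle, real_inner_smul_left, real_inner_comm]; ring
  have hnorm : ‖v‖ ^ 2 = ∑ i, inner ℝ (e i) v ^ 2 := by
    rw [← e.sum_sq_norm_inner_right v]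
    simp
  rw [hnorm]
  refine Finset.sum_le_sum (g := fun i => (LinearMap.trace ℝ E K.toLinearMap)
    * (l i * inner ℝ (e i) v ^ 2)) (fun i _ => ?_) |>.trans_eq ?_
  · have : (l i)⁻¹ ≤ LinearMap.trace ℝ E K.toLinearMap := by
      rw [htr]
      exact Finset.single_le_sum (f := fun i => (l i)⁻¹)
        (fun j _ => (inv_pos.2 (hlpos j)).le) (Finset.mem_univ i)
    have h1 : 1 ≤ LinearMap.trace ℝ E K.toLinearMap * l i := by
      rwa [inv_le_iff_one_le_mul₀ (hlpos i)] at this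
    nlinarith [sq_nonneg (inner ℝ (e i) v)]
  · rw [hin, Finset.mul_sum]

theorem trace_le_finrank_mul_opNorm [FiniteDimensional ℝ E] (K : E →L[ℝ] E) :
    LinearMap.trace ℝ E K.toLinearMap ≤ Module.finrank ℝ E * ‖K‖ := by
  set e := stdOrthonormalBasis ℝ E
  rw [LinearMap.trace_eq_sum_inner _ e]
  calc _ ≤ ∑ _i : Fin (Module.finrank ℝ E), ‖K‖ := by
        refine Finset.sum_le_sum fun i _ => ?_
        refine (real_inner_le_norm _ _).trans ?_
        have := K.le_opNorm (e i)
        simpa using this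
    _ = _ := by simp

theorem norm_le_of_inner_bound {H : E →L[ℝ] E} {c : ℝ}
    (hH : ∀ v, c * ‖v‖ ^ 2 ≤ inner ℝ v (H v)) (v : E) : c * ‖v‖ ≤ ‖H v‖ := by
  rcases eq_or_ne v 0 with rfl | hv
  · simp
  have h1 := (hH v).trans (real_inner_le_norm _ _)
  have : 0 < ‖v‖ := norm_pos_iff.2 hv
  nlinarith

theorem exists_apply_eq_of_orthogonal_ker [FiniteDimensional ℝ E] {Q : E →L[ℝ] E}
    (hs : Q.IsSymmetric) {w : E}
    (hw : ∀ v, Q v = 0 → inner ℝ v w = 0) : ∃ z, Q z = w := by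
  have hadj : ContinuousLinearMap.adjoint Q = Q :=
    (ContinuousLinearMap.isSelfAdjoint_iff_isSymmetric.2 hs)
  have h1 : w ∈ Q.toLinearMap.rangeᗮᗮ := by
    rw [ContinuousLinearMap.orthogonal_range, hadj]
    intro v hv
    exact hw v (by simpa using hv)
  rw [Submodule.orthogonal_orthogonal] at h1
  simpa using h1

/-- If `t H₀ x + (1 - t) Q x = Q z` with `H₀` positive definite, `Q` positive semidefinite and
`t ≤ 1/2`, then `x` is bounded by `z`, uniformly in `t`. -/
theorem norm_le_of_interpolation_eq {H₀ Q : E →L[ℝ] E} {c₀ t : ℝ}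
    (hc₀ : 0 < c₀) (hH : ∀ v, c₀ * ‖v‖ ^ 2 ≤ inner ℝ v (H₀ v))
    (hQ : ∀ v, 0 ≤ inner ℝ v (Q v)) (ht : 0 < t) (ht2 : t ≤ 1 / 2) {x z : E}
    (hx : t • H₀ x + (1 - t) • Q x = Q z) : ‖x‖ ≤ 2 * ‖H₀‖ / c₀ * ‖z‖ := by
  have h1 : t • H₀ x = Q (z - (1 - t) • x) := by
    rw [map_sub, map_smul, ← hx]; abel
  -- Testing `Q` on this vector eliminates `Q` and lets the small factor `t` cancel, which makes the
  -- bound uniform in `t`.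
  have h2 := hQ (z - (1 - t) • x)
  rw [← h1, real_inner_smul_right, inner_sub_left, real_inner_smul_left] at h2
  have h3 : (1 - t) * inner ℝ x (H₀ x) ≤ inner ℝ z (H₀ x) := by
    have := (mul_nonneg_iff_of_pos_left ht).1 h2
    linarith
  have h4 : inner ℝ z (H₀ x) ≤ ‖z‖ * (‖H₀‖ * ‖x‖) :=
    (real_inner_le_norm _ _).trans (mul_le_mul_of_nonneg_left (H₀.le_opNorm x) (norm_nonneg _))
  have h5 := hH x
  have h6 : c₀ * ‖x‖ ^ 2 ≤ 2 * (‖z‖ * (‖H₀‖ * ‖x‖)) := by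
    have : 0 ≤ inner ℝ x (H₀ x) := (by positivity : 0 ≤ c₀ * ‖x‖ ^ 2).trans h5
    nlinarith
  rcases eq_or_lt_of_le (norm_nonneg x) with h | h
  · rw [← h]; positivity
  rw [div_mul_eq_mul_div, le_div_iff₀ hc₀]
  nlinarith

/-- Completing the square: the Gaussian with Hessian `α H` and gradient `H m` at `0` is centred at
`-α⁻¹ m`. -/
theorem inner_add_quadratic_eq {H : E →L[ℝ] E} (hHs : H.IsSymmetric) {α : ℝ} (hα : α ≠ 0)
    (m u : E) : inner ℝ (H m) u + α / 2 * inner ℝ u (H u)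
      = α / 2 * inner ℝ (u + α⁻¹ • m) (H (u + α⁻¹ • m)) - inner ℝ m (H m) / (2 * α) := by
  have h1 : inner ℝ (H m) u = inner ℝ m (H u) := hHs m u
  have h2 : inner ℝ u (H m) = inner ℝ m (H u) := by rw [real_inner_comm, h1]
  simp only [map_add, map_smul, inner_add_left, inner_add_right, real_inner_smul_left,
    real_inner_smul_right, h1, h2]
  field_simp
  ring

end LinearAlgebra

/-! ### Gaussian integrals and the Laplace comparison on a ball. -/

section GaussianIntegrals

variable {E : Type*} [NormedAddCommGroup E] [InnerProductSpace ℝ E] [FiniteDimensional ℝ E]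
  [MeasurableSpace E] [BorelSpace E]

theorem integrable_exp_neg_mul_sq_norm {b : ℝ} (hb : 0 < b) :
    Integrable fun v : E => Real.exp (-b * ‖v‖ ^ 2) := by
  have h := (GaussianFourier.integrable_cexp_neg_mul_sq_norm_add (V := E) (b := (b : ℂ))
    (by simpa using hb) 0 0).re
  refine h.congr (Eventually.of_forall fun v => ?_)
  have : -(b : ℂ) * (‖v‖ : ℂ) ^ 2 + 0 * ((inner ℝ (0 : E) v : ℝ) : ℂ)
      = ((-b * ‖v‖ ^ 2 : ℝ) : ℂ) := by push_cast; ring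
  simp only [this]
  exact Complex.exp_ofReal_re _

theorem integrable_exp_neg_mul_quadratic {H : E →L[ℝ] E} {c a : ℝ} (hc : 0 < c)
    (hH : ∀ v, c * ‖v‖ ^ 2 ≤ inner ℝ v (H v)) (ha : 0 < a) :
    Integrable fun v : E => Real.exp (-a * inner ℝ v (H v)) := by
  refine (integrable_exp_neg_mul_sq_norm (E := E) (mul_pos ha hc)).mono'
    (by fun_prop) (Eventually.of_forall fun v => ?_)
  rw [Real.norm_of_nonneg (Real.exp_pos _).le, Real.exp_le_exp]
  nlinarith [mul_le_mul_of_nonneg_left (hH v) ha.le]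

/-- Substituting `√(a / b) v` compares two Gaussian normalising constants with proportional
precision matrices, so no determinant has to be computed. -/
theorem integral_exp_neg_mul_quadratic_scale (H : E →L[ℝ] E) {a b : ℝ} (ha : 0 < a) (hb : 0 < b) :
    ∫ v : E, Real.exp (-a * inner ℝ v (H v))
      = (b / a) ^ ((Module.finrank ℝ E : ℝ) / 2) * ∫ v : E, Real.exp (-b * inner ℝ v (H v)) := by
  have hab : 0 < a / b := div_pos ha hb
  have h := Measure.integral_comp_smul (volume : Measure E)
    (fun v : E => Real.exp (-b * inner ℝ v (H v))) (Real.sqrt (a / b))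
  have e : ∀ v : E, -b * inner ℝ (Real.sqrt (a / b) • v) (H (Real.sqrt (a / b) • v))
      = -a * inner ℝ v (H v) := fun v => by
    rw [map_smul, real_inner_smul_left, real_inner_smul_right, ← mul_assoc (√(a / b)),
      Real.mul_self_sqrt hab.le]
    field_simp
  simp only [e] at h
  rw [h, smul_eq_mul, abs_of_nonneg (by positivity)]
  congr 1
  rw [Real.sqrt_eq_rpow, ← Real.rpow_natCast, ← Real.rpow_mul hab.le, ← Real.inv_rpow hab.le,
    inv_div]
  congr 1
  ring

/-- Half of the exponent yields the factor `exp (-θ t²)` beyond radius `t`; the other half remains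
as a Gaussian of doubled covariance, whose normalisation costs `2 ^ (d / 2)`. -/
theorem setIntegral_norm_gt_exp_neg_mul_quadratic_le {H : E →L[ℝ] E} {c a θ : ℝ} (hc : 0 < c)
    (hH : ∀ v, c * ‖v‖ ^ 2 ≤ inner ℝ v (H v)) (ha : 0 < a) (hθ0 : 0 ≤ θ)
    (hθ : ∀ v, θ * ‖v‖ ^ 2 ≤ a / 2 * inner ℝ v (H v)) {t : ℝ} (ht : 0 ≤ t) :
    ∫ v in {v : E | t < ‖v‖}, Real.exp (-a * inner ℝ v (H v))
      ≤ Real.exp (-θ * t ^ 2) * 2 ^ ((Module.finrank ℝ E : ℝ) / 2)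
        * ∫ v : E, Real.exp (-a * inner ℝ v (H v)) := by
  have hi := integrable_exp_neg_mul_quadratic hc hH ha
  have hi2 := integrable_exp_neg_mul_quadratic hc hH (half_pos ha)
  have hm : MeasurableSet {v : E | t < ‖v‖} := measurableSet_lt measurable_const measurable_norm
  calc _ ≤ ∫ v in {v : E | t < ‖v‖}, Real.exp (-θ * t ^ 2) *
          Real.exp (-(a / 2) * inner ℝ v (H v)) := by
        refine setIntegral_mono_on hi.integrableOn (hi2.const_mul _).integrableOn hm fun v hv => ?_
        rw [← Real.exp_add, Real.exp_le_exp]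
        have h1 : t ^ 2 ≤ ‖v‖ ^ 2 := pow_le_pow_left₀ ht (le_of_lt hv) 2
        have h2 := hθ v
        nlinarith [mul_le_mul_of_nonneg_left h1 hθ0]
    _ ≤ ∫ v : E, Real.exp (-θ * t ^ 2) * Real.exp (-(a / 2) * inner ℝ v (H v)) :=
        setIntegral_le_integral (hi2.const_mul _)
          (Eventually.of_forall fun v => by positivity)
    _ = _ := by
        rw [integral_const_mul, integral_exp_neg_mul_quadratic_scale H (half_pos ha) ha,
          mul_assoc]
        congr 3
        field_simp

theorem setIntegral_comp_add_right (f : E → ℝ) (w : E) (s : Set E) :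
    ∫ u in (fun u => u + w) ⁻¹' s, f (u + w) = ∫ v in s, f v :=
  (measurePreserving_add_right volume w).setIntegral_preimage_emb
    (measurableEmbedding_addRight w) f s

/-- Laplace approximation of the tail of a perturbed Gaussian density on a ball: if `φ` lies
between two quadratic functions with the same gradient `H m` at `0` and Hessians `(1 ± l) H`, then
the fraction of `exp (-φ / τ)` at distance more than `β + t` from the centre is exponentially
small. -/
theorem setIntegral_ball_tail_le {H : E →L[ℝ] E} (hHs : H.IsSymmetric) {c : ℝ} (hc : 0 < c)
    (hH : ∀ v, c * ‖v‖ ^ 2 ≤ inner ℝ v (H v)) {T τ l β δ t ε : ℝ} {m : E} {φ : E → ℝ}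
    (hT : 0 < T) (hTH : ∀ v, ‖v‖ ^ 2 ≤ T * inner ℝ v (H v)) (hτ : 0 < τ) (hl0 : 0 ≤ l)
    (hl1 : l < 1) (hm : ‖m‖ ≤ (1 - l) * β) (hβδ : β ≤ δ) (ht : 0 ≤ t) (hε : β + t ≤ ε)
    (hint : IntegrableOn (fun u => Real.exp (-φ u / τ)) (Metric.closedBall 0 δ))
    (hlow : ∀ u ∈ Metric.closedBall (0 : E) δ,
      inner ℝ (H m) u + (1 - l) / 2 * inner ℝ u (H u) ≤ φ u)
    (hupp : ∀ u ∈ Metric.closedBall (0 : E) δ,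
      φ u ≤ inner ℝ (H m) u + (1 + l) / 2 * inner ℝ u (H u))
    (hρ : Real.exp (-((1 + l) / (4 * τ * T)) * (δ - β) ^ 2)
      * 2 ^ ((Module.finrank ℝ E : ℝ) / 2) ≤ 1 / 2) :
    ∫ u in Metric.closedBall (0 : E) δ ∩ {u | ε < ‖u‖}, Real.exp (-φ u / τ)
      ≤ Real.exp (inner ℝ m (H m) * l / (τ * (1 - l ^ 2)))
        * ((1 + l) / (1 - l)) ^ ((Module.finrank ℝ E : ℝ) / 2)
        * (2 * 2 ^ ((Module.finrank ℝ E : ℝ) / 2)) * Real.exp (-((1 - l) / (4 * τ * T)) * t ^ 2)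
        * ∫ u in Metric.closedBall (0 : E) δ, Real.exp (-φ u / τ) := by
  set d : ℝ := (Module.finrank ℝ E : ℝ) / 2
  have hα : 0 < 1 - l := by linarith
  have hα' : 0 < 1 + l := by linarith
  have hβ0 : 0 ≤ β := by
    by_contra h
    nlinarith [norm_nonneg m]
  have ha : 0 < (1 - l) / (2 * τ) := by positivity
  have hb : 0 < (1 + l) / (2 * τ) := by positivity
  have hia := integrable_exp_neg_mul_quadratic hc hH ha
  have hib := integrable_exp_neg_mul_quadratic hc hH hb
  have hθ : ∀ α : ℝ, 0 < α → ∀ v : E,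
      α / (4 * τ * T) * ‖v‖ ^ 2 ≤ α / (2 * τ) / 2 * inner ℝ v (H v) := fun α hα v => by
    have := mul_le_mul_of_nonneg_left (hTH v) (by positivity : 0 ≤ α / (4 * τ * T))
    refine this.trans_eq ?_
    field_simp
    ring
  set S : Set E := Metric.closedBall (0 : E) δ ∩ {u | ε < ‖u‖}
  have hSm : MeasurableSet S := Metric.isClosed_closedBall.measurableSet.inter
    (measurableSet_lt measurable_const measurable_norm)
  set N : ℝ → ℝ := fun a => ∫ v : E, Real.exp (-a * inner ℝ v (H v))
  have expand : ∀ α : ℝ, 0 < α → ∀ u : E,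
      Real.exp (-(inner ℝ (H m) u + α / 2 * inner ℝ u (H u)) / τ)
        = Real.exp (inner ℝ m (H m) / (2 * α * τ)) * Real.exp (-(α / (2 * τ))
          * inner ℝ (u + α⁻¹ • m) (H (u + α⁻¹ • m))) := fun α hα u => by
    rw [← Real.exp_add, inner_add_quadratic_eq hHs hα.ne']
    congr 1
    field_simp
    ring
  have hshift : ∀ α : ℝ, 0 < α → Integrable fun u : E =>
      Real.exp (-(inner ℝ (H m) u + α / 2 * inner ℝ u (H u)) / τ) := fun α hα => by
    simp only [expand α hα]
    refine Integrable.const_mul ?_ _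
    exact (integrable_exp_neg_mul_quadratic hc hH
      (by positivity : 0 < α / (2 * τ))).comp_add_right (α⁻¹ • m)
  -- The flatter Gaussian dominates the numerator. Its centre is within `β` of `0`, so `‖u‖ > ε ≥ β
  -- + t` forces distance more than `t` from that centre.
  have hnum : ∫ u in S, Real.exp (-φ u / τ) ≤ Real.exp (inner ℝ m (H m) / (2 * (1 - l) * τ)) *
      (Real.exp (-((1 - l) / (4 * τ * T)) * t ^ 2) * 2 ^ d * N ((1 - l) / (2 * τ))) := by
    calc _ ≤ ∫ u in S,
          Real.exp (-(inner ℝ (H m) u + (1 - l) / 2 * inner ℝ u (H u)) / τ) := by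
          refine setIntegral_mono_on (hint.mono_set inter_subset_left)
            (hshift _ hα).integrableOn hSm fun u hu => ?_
          rw [Real.exp_le_exp]
          have := hlow u hu.1
          gcongr
      _ ≤ ∫ u in (fun u => u + (1 - l)⁻¹ • m) ⁻¹' {v : E | t < ‖v‖},
          Real.exp (-(inner ℝ (H m) u + (1 - l) / 2 * inner ℝ u (H u)) / τ) := by
          refine setIntegral_mono_set (hshift _ hα).integrableOn
            (Eventually.of_forall fun u => (Real.exp_pos _).le) (LE.le.eventuallyLE ?_)
          rintro u ⟨-, hu⟩
          simp only [mem_preimage, mem_ofPred_eq] at hu ⊢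
          have h1 : ‖(1 - l)⁻¹ • m‖ ≤ β := by
            rw [norm_smul, norm_inv, Real.norm_of_nonneg hα.le, inv_mul_le_iff₀ hα]
            exact hm
          have h2 : ‖u‖ ≤ ‖u + (1 - l)⁻¹ • m‖ + ‖(1 - l)⁻¹ • m‖ := by
            simpa using norm_sub_le (u + (1 - l)⁻¹ • m) ((1 - l)⁻¹ • m)
          linarith
      _ = Real.exp (inner ℝ m (H m) / (2 * (1 - l) * τ)) *
          ∫ v in {v : E | t < ‖v‖}, Real.exp (-((1 - l) / (2 * τ)) * inner ℝ v (H v)) := by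
          simp only [expand _ hα]
          rw [integral_const_mul, setIntegral_comp_add_right
            (fun v : E => Real.exp (-((1 - l) / (2 * τ)) * inner ℝ v (H v)))]
      _ ≤ _ := by
          gcongr
          exact setIntegral_norm_gt_exp_neg_mul_quadratic_le hc hH ha (by positivity)
            (hθ _ hα) ht
  -- The steeper Gaussian bounds the denominator from below. The ball of radius `δ - β` about its
  -- centre lies in `B(0, δ)` and, by `hρ`, carries at least half of its mass.
  have hden : Real.exp (inner ℝ m (H m) / (2 * (1 + l) * τ)) * (N ((1 + l) / (2 * τ)) / 2)
      ≤ ∫ u in Metric.closedBall (0 : E) δ, Real.exp (-φ u / τ) := by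
    calc _ ≤ Real.exp (inner ℝ m (H m) / (2 * (1 + l) * τ)) *
          ∫ v in {v : E | δ - β < ‖v‖}ᶜ, Real.exp (-((1 + l) / (2 * τ)) * inner ℝ v (H v)) := by
          have h1 := integral_add_compl (μ := volume) (s := {v : E | δ - β < ‖v‖})
            (measurableSet_lt measurable_const measurable_norm) hib
          have h2 := setIntegral_norm_gt_exp_neg_mul_quadratic_le hc hH hb (by positivity)
            (hθ _ hα') (sub_nonneg.2 hβδ)
          have h3 : 0 ≤ N ((1 + l) / (2 * τ)) := integral_nonneg fun v => (Real.exp_pos _).le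
          have h4 := mul_le_mul_of_nonneg_right hρ h3
          gcongr
          simp only [N, d] at h2 h4 ⊢
          linarith
      _ = ∫ u in (fun u => u + (1 + l)⁻¹ • m) ⁻¹' {v : E | δ - β < ‖v‖}ᶜ,
          Real.exp (-(inner ℝ (H m) u + (1 + l) / 2 * inner ℝ u (H u)) / τ) := by
          simp only [expand _ hα']
          rw [integral_const_mul, setIntegral_comp_add_right
            (fun v : E => Real.exp (-((1 + l) / (2 * τ)) * inner ℝ v (H v)))]
      _ ≤ ∫ u in Metric.closedBall (0 : E) δ,
          Real.exp (-(inner ℝ (H m) u + (1 + l) / 2 * inner ℝ u (H u)) / τ) := by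
          refine setIntegral_mono_set (hshift _ hα').integrableOn
            (Eventually.of_forall fun u => (Real.exp_pos _).le) (LE.le.eventuallyLE ?_)
          intro u hu
          simp only [mem_preimage, mem_compl_iff, mem_ofPred_eq, not_lt] at hu
          rw [mem_closedBall_zero_iff]
          have h1 : ‖(1 + l)⁻¹ • m‖ ≤ β := by
            rw [norm_smul, norm_inv, Real.norm_of_nonneg hα'.le, inv_mul_le_iff₀ hα']
            exact hm.trans (by gcongr; linarith)
          have h2 : ‖u‖ ≤ ‖u + (1 + l)⁻¹ • m‖ + ‖(1 + l)⁻¹ • m‖ := by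
            simpa using norm_sub_le (u + (1 + l)⁻¹ • m) ((1 + l)⁻¹ • m)
          linarith
      _ ≤ _ := by
          refine setIntegral_mono_on (hshift _ hα').integrableOn hint
            Metric.isClosed_closedBall.measurableSet fun u hu => ?_
          rw [Real.exp_le_exp]
          have := hupp u hu
          gcongr
  have hN : N ((1 - l) / (2 * τ)) = ((1 + l) / (1 - l)) ^ d * N ((1 + l) / (2 * τ)) := by
    simp only [N]
    rw [integral_exp_neg_mul_quadratic_scale H ha hb]
    rw [div_div_div_cancel_right₀ (by positivity)]
  -- The constants left by completing the two squares differ by `(1 / (1 - l) - 1 / (1 + l)) / 2 = l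
  -- / (1 - l²)`.
  have hE : Real.exp (inner ℝ m (H m) / (2 * (1 - l) * τ))
      = Real.exp (inner ℝ m (H m) * l / (τ * (1 - l ^ 2)))
        * Real.exp (inner ℝ m (H m) / (2 * (1 + l) * τ)) := by
    rw [← Real.exp_add]
    congr 1
    have : 1 - l ^ 2 = (1 - l) * (1 + l) := by ring
    rw [this]
    field_simp
    ring
  refine hnum.trans ?_
  rw [hN, hE]
  refine le_trans (le_of_eq ?_) (mul_le_mul_of_nonneg_left hden (by positivity))
  ring

end GaussianIntegrals

/-! ### Second-order Taylor bounds and derivatives along lines. -/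

section Taylor

/-- Monotonicity is used twice, first for `φ'` and then for `φ`, so `φ''` need not be continuous.
Applied to `-φ` it gives the lower bound. -/
theorem le_taylor_two_of_deriv_le {φ φ' φ'' : ℝ → ℝ} {c : ℝ}
    (h1 : ∀ t ∈ Icc (0 : ℝ) 1, HasDerivAt φ (φ' t) t)
    (h2 : ∀ t ∈ Icc (0 : ℝ) 1, HasDerivAt φ' (φ'' t) t)
    (hc : ∀ t ∈ Icc (0 : ℝ) 1, φ'' t ≤ c) : φ 1 ≤ φ 0 + φ' 0 + c / 2 := by
  have anti : ∀ F F' : ℝ → ℝ, (∀ t ∈ Icc (0 : ℝ) 1, HasDerivAt F (F' t) t) →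
      (∀ t ∈ Icc (0 : ℝ) 1, F' t ≤ 0) → AntitoneOn F (Icc 0 1) := fun F F' hF hF' => by
    refine antitoneOn_of_deriv_nonpos (convex_Icc 0 1)
      (fun t ht => (hF t ht).continuousAt.continuousWithinAt)
      (fun t ht => (hF t (interior_subset ht)).differentiableAt.differentiableWithinAt)
      fun t ht => ?_
    rw [(hF t (interior_subset ht)).deriv]
    exact hF' t (interior_subset ht)
  have h0 : (0 : ℝ) ∈ Icc (0 : ℝ) 1 := by simp
  have a1 := anti (fun t => φ' t - c * t) (fun t => φ'' t - c * 1)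
    (fun t ht => (h2 t ht).sub ((hasDerivAt_id t).const_mul c))
    (fun t ht => by have := hc t ht; linarith)
  have a2 := anti (fun t => φ t - (φ' 0 * t + c * (t ^ 2 / 2)))
    (fun t => φ' t - (φ' 0 * 1 + c * t))
    (fun t ht => (h1 t ht).sub (((hasDerivAt_id t).const_mul _).add
      ((((hasDerivAt_id t).pow 2).div_const 2).const_mul c |>.congr_deriv (by simp))))
    (fun t ht => by
      have := a1 h0 ht ht.1
      simp only [mul_zero, sub_zero] at this
      linarith)
  have := a2 h0 (by simp : (1 : ℝ) ∈ Icc (0 : ℝ) 1) zero_le_one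
  simp only [mul_zero] at this
  linarith

theorem hasGradientAt_of_contDiffAt {d : ℕ} {F : Euc d → ℝ} {x : Euc d}
    (h : ContDiffAt ℝ 2 F x) : HasGradientAt F (gradient F x) x :=
  (h.differentiableAt (by norm_num)).hasGradientAt

theorem hasFDerivAt_fderiv_of_contDiffAt {d : ℕ} {F : Euc d → ℝ} {x : Euc d}
    (h : ContDiffAt ℝ 2 F x) : HasFDerivAt (fderiv ℝ F) (fderiv ℝ (fderiv ℝ F) x) x :=
  ((h.fderiv_right (m := 1) (by norm_num)).differentiableAt (by norm_num)).hasFDerivAt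

theorem hasFDerivAt_gradient_of_contDiffAt {d : ℕ} {F : Euc d → ℝ} {x : Euc d}
    (h : ContDiffAt ℝ 2 F x) : HasFDerivAt (gradient F) (hess F x) x := by
  have h1 := ((InnerProductSpace.toDual ℝ (Euc d)).symm.toContinuousLinearEquiv
    |>.toContinuousLinearMap.hasFDerivAt).comp x (hasFDerivAt_fderiv_of_contDiffAt h)
  exact (show DifferentiableAt ℝ (gradient F) x from h1.differentiableAt).hasFDerivAt

theorem inner_hess {d : ℕ} {F : Euc d → ℝ} {x : Euc d}
    (h : ContDiffAt ℝ 2 F x) (u v : Euc d) :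
    inner ℝ (hess F x u) v = fderiv ℝ (fderiv ℝ F) x u v := by
  have h1 : HasFDerivAt (fun z => inner ℝ (gradient F z) v) _ x :=
    (hasFDerivAt_gradient_of_contDiffAt h).inner ℝ (hasFDerivAt_const v x)
  have h2 : HasFDerivAt (fun z => fderiv ℝ F z v) _ x :=
    (hasFDerivAt_fderiv_of_contDiffAt h).clm_apply (hasFDerivAt_const v x)
  have e : (fun z => inner ℝ (gradient F z) v) = fun z => fderiv ℝ F z v := by
    funext z
    simp [gradient]
  rw [e] at h1
  have := congrArg (fun T => T u) (h1.unique h2)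
  simpa using this

theorem isSymmetric_hess {d : ℕ} {F : Euc d → ℝ} {x : Euc d}
    (h : ContDiffAt ℝ 2 F x) : (hess F x).IsSymmetric := by
  intro u v
  have h1 : IsSymmSndFDerivAt ℝ F x := h.isSymmSndFDerivAt (by simp)
  have h2 : inner ℝ (hess F x u) v = inner ℝ u (hess F x v) := by
    rw [(inner_hess h), h1 u v, ← (inner_hess h), real_inner_comm]
  exact h2

theorem hasDerivAt_line_of_contDiffAt {d : ℕ} {F : Euc d → ℝ} {x w : Euc d} {t : ℝ}
    (h : ContDiffAt ℝ 2 F (x + t • w)) :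
    HasDerivAt (fun s : ℝ => F (x + s • w)) (inner ℝ (gradient F (x + t • w)) w) t := by
  have hl : HasDerivAt (fun s : ℝ => x + s • w) w t := by
    simpa using ((hasDerivAt_id t).smul_const w).const_add x
  have := (hasGradientAt_of_contDiffAt h).hasFDerivAt.comp_hasDerivAt t hl
  simpa using! this

theorem hasDerivAt_inner_gradient_line {d : ℕ} {F : Euc d → ℝ} {x w : Euc d} {t : ℝ}
    (h : ContDiffAt ℝ 2 F (x + t • w)) :
    HasDerivAt (fun s : ℝ => inner ℝ (gradient F (x + s • w)) w)
      (inner ℝ w (hess F (x + t • w) w)) t := by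
  have hl : HasDerivAt (fun s : ℝ => x + s • w) w t := by
    simpa using ((hasDerivAt_id t).smul_const w).const_add x
  have := ((hasFDerivAt_gradient_of_contDiffAt h).comp_hasDerivAt t hl).inner ℝ (hasDerivAt_const t w)
  refine this.congr_deriv ?_
  simp [real_inner_comm]

theorem inner_gradient_eq_zero_of_isLocalMin {d : ℕ} {F : Euc d → ℝ} {x w : Euc d}
    (h : ContDiffAt ℝ 2 F x) (hmin : IsLocalMin (fun s : ℝ => F (x + s • w)) 0) :
    inner ℝ (gradient F x) w = 0 := by
  have h0 : ContDiffAt ℝ 2 F (x + (0 : ℝ) • w) := by simpa using h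
  simpa using hmin.hasDerivAt_eq_zero (hasDerivAt_line_of_contDiffAt h0)

end Taylor

/-! ### Expansion of `h_y` and first-order conditions at `xs`. -/

namespace GLIP

variable {n p : ℕ} (M : GLIP n p)

/-- The gradient of `h_y`. -/
def gradH (τ : ℝ) (y : Euc n) (x : Euc p) : Euc p :=
  M.A.adjoint (gradient (M.f y) (M.A x)) + M.nu τ • gradient M.g x

theorem abs_h_sub_taylor_le {xs : Euc p} {τ δ : ℝ} {y : Euc n}
    (hf : ∀ x ∈ Metric.closedBall xs δ, ContDiffAt ℝ 2 (M.f y) (M.A x))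
    (hg : ∀ x ∈ Metric.closedBall xs δ, ContDiffAt ℝ 2 M.g x) {H B : Euc p →L[ℝ] Euc p}
    (hB : ∀ x ∈ Metric.closedBall xs δ, ∀ v, |inner ℝ (M.A v) (hess (M.f y) (M.A x) (M.A v))
      + M.nu τ * inner ℝ v (hess M.g x v) - inner ℝ v (H v)| ≤ inner ℝ v (B v))
    {u : Euc p} (hu : u ∈ Metric.closedBall (0 : Euc p) δ) :
    |M.h τ y (xs + u) - M.h τ y xs - inner ℝ (M.gradH τ y xs) u - 1 / 2 * inner ℝ u (H u)|
      ≤ 1 / 2 * inner ℝ u (B u) := by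
  have hmem : ∀ t ∈ Icc (0 : ℝ) 1, xs + t • u ∈ Metric.closedBall xs δ := fun t ht => by
    rw [mem_closedBall_zero_iff] at hu
    simp only [mem_closedBall_iff_norm, add_sub_cancel_left, norm_smul, Real.norm_of_nonneg ht.1]
    nlinarith [ht.2, norm_nonneg u]
  have hA : ∀ t : ℝ, M.A (xs + t • u) = M.A xs + t • M.A u := fun t => by simp
  set φ : ℝ → ℝ := fun t => M.f y (M.A xs + t • M.A u) + M.nu τ * M.g (xs + t • u)
  set φ' : ℝ → ℝ := fun t => inner ℝ (gradient (M.f y) (M.A xs + t • M.A u)) (M.A u)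
    + M.nu τ * inner ℝ (gradient M.g (xs + t • u)) u
  set φ'' : ℝ → ℝ := fun t => inner ℝ (M.A u) (hess (M.f y) (M.A xs + t • M.A u) (M.A u))
    + M.nu τ * inner ℝ u (hess M.g (xs + t • u) u)
  have hf' : ∀ t ∈ Icc (0 : ℝ) 1, ContDiffAt ℝ 2 (M.f y) (M.A xs + t • M.A u) := fun t ht => by
    rw [← hA]; exact hf _ (hmem t ht)
  have h1 : ∀ t ∈ Icc (0 : ℝ) 1, HasDerivAt φ (φ' t) t := fun t ht =>
    (hasDerivAt_line_of_contDiffAt (hf' t ht)).add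
      ((hasDerivAt_line_of_contDiffAt (hg _ (hmem t ht))).const_mul _)
  have h2 : ∀ t ∈ Icc (0 : ℝ) 1, HasDerivAt φ' (φ'' t) t := fun t ht =>
    (hasDerivAt_inner_gradient_line (hf' t ht)).add
      ((hasDerivAt_inner_gradient_line (hg _ (hmem t ht))).const_mul _)
  have h3 : ∀ t ∈ Icc (0 : ℝ) 1, |φ'' t - inner ℝ u (H u)| ≤ inner ℝ u (B u) := fun t ht => by
    have := hB _ (hmem t ht) u
    rwa [hA] at this
  have up := le_taylor_two_of_deriv_le h1 h2 (c := inner ℝ u (H u) + inner ℝ u (B u))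
    fun t ht => by have := (abs_le.1 (h3 t ht)).2; linarith
  have lo := le_taylor_two_of_deriv_le (fun t ht => (h1 t ht).neg) (fun t ht => (h2 t ht).neg)
    (c := -(inner ℝ u (H u) - inner ℝ u (B u)))
    fun t ht => by have := (abs_le.1 (h3 t ht)).1; linarith
  have e1 : φ 1 = M.h τ y (xs + u) := by simp [φ, h]
  have e0 : φ 0 = M.h τ y xs := by simp [φ, h]
  have e2 : φ' 0 = inner ℝ (M.gradH τ y xs) u := by
    simp [φ', gradH, inner_add_left, real_inner_smul_left, ContinuousLinearMap.adjoint_inner_left]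
  simp only [Pi.neg_apply] at lo
  rw [e0, e1, e2] at up lo
  rw [abs_le]
  constructor <;> linarith

variable {M} in
-- By identifiability, `x ↦ f̃_{y*}(A x)` is minimal over `X` at the interior point `xs`, so its
-- gradient, which is the left-hand side, vanishes.
theorem IsModel.adjoint_gradient_eq_zero (hM : M.IsModel) {xs : Euc p}
    (hxs : M.A xs = M.A M.xtrue) (hint : xs ∈ interior M.X)
    (hf : ContDiffAt ℝ 2 (M.f M.yexact) (M.A xs)) :
    M.A.adjoint (gradient (M.f M.yexact) (M.A xs)) = 0 := by
  refine ext_inner_right ℝ fun v => ?_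
  rw [ContinuousLinearMap.adjoint_inner_left, inner_zero_left]
  apply inner_gradient_eq_zero_of_isLocalMin hf
  have hc : Tendsto (fun s : ℝ => xs + s • v) (𝓝 0) (𝓝 xs) := by
    have : Continuous fun s : ℝ => xs + s • v := by fun_prop
    simpa using this.tendsto 0
  filter_upwards [hc.eventually (mem_interior_iff_mem_nhds.1 hint)] with s hs
  have e : M.A xs + s • M.A v = M.A (xs + s • v) := by simp
  simp only [e, zero_smul, add_zero]
  rcases eq_or_ne (M.A (xs + s • v)) (M.A xs) with h | h
  · rw [h]
  · rw [hxs] at h ⊢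
    exact (hM.identifiable _ ⟨_, hM.xtrue_mem, rfl⟩ _ ⟨_, hs, rfl⟩ h).le

variable {M} in
-- Moving from `xs` along the kernel of `A` stays in the fibre on which `xs` minimises `g`.
theorem IsLimitPoint.inner_gradient_eq_zero {xs : Euc p} (hxs : M.IsLimitPoint xs)
    (hint : xs ∈ interior M.X) (hg : ContDiffAt ℝ 2 M.g xs) {v : Euc p} (hv : M.A v = 0) :
    inner ℝ v (gradient M.g xs) = 0 := by
  rw [real_inner_comm]
  apply inner_gradient_eq_zero_of_isLocalMin hg
  have hc : Tendsto (fun s : ℝ => xs + s • v) (𝓝 0) (𝓝 xs) := by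
    have : Continuous fun s : ℝ => xs + s • v := by fun_prop
    simpa using this.tendsto 0
  filter_upwards [hc.eventually (mem_interior_iff_mem_nhds.1 hint)] with s hs
  simp only [zero_smul, add_zero]
  rcases eq_or_ne (xs + s • v) xs with h | h
  · rw [h]
  · exact (hxs.2.2 _ hs (by simp [hv, hxs.2.1]) h).le

end GLIP

/-! ### Uniform bounds for a degenerate operator with a small regularisation. -/

section Regularisation

variable {E : Type*} [NormedAddCommGroup E] [InnerProductSpace ℝ E]

/-- A positive semidefinite `Q` perturbed by a small multiple of `G`, where `Q + ν G` is positive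
definite: the perturbed operator is bounded below, and its inverse is bounded on the range
of `Q`. -/
theorem exists_coercive_of_regularised [FiniteDimensional ℝ E] {Q G : E →L[ℝ] E}
    (hQ : ∀ v, 0 ≤ inner ℝ v (Q v)) {ν : ℝ → ℝ}
    {l : Filter ℝ} [l.NeBot] (hν : Tendsto ν l (𝓝 0)) (hνpos : ∀ᶠ τ in l, 0 < ν τ)
    (hH : ∀ᶠ τ in l, ∀ v, v ≠ 0 → 0 < inner ℝ v ((Q + ν τ • G) v)) :
    ∃ c : ℝ, 0 < c ∧ ∃ K : ℝ, 0 ≤ K ∧ ∀ᶠ τ in l,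
      (∀ v, c * ν τ * ‖v‖ ^ 2 + 1 / 2 * inner ℝ v (Q v) ≤ inner ℝ v ((Q + ν τ • G) v)) ∧
      ∀ x z, (Q + ν τ • G) x = Q z → ‖x‖ ≤ K * ‖z‖ := by
  obtain ⟨τ₀, hτ₀, hν₀⟩ := (hH.and hνpos).exists
  set H₀ := Q + ν τ₀ • G with hH₀
  obtain ⟨c₀, hc₀, hc⟩ := ContinuousLinearMap.exists_pos_mul_sq_le_inner hτ₀
  refine ⟨c₀ / ν τ₀, by positivity, 2 * ‖H₀‖ / c₀, by positivity, ?_⟩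
  filter_upwards [hνpos, hν.eventually (gt_mem_nhds (half_pos hν₀))] with τ h0 h1
  set t := ν τ / ν τ₀ with ht
  have ht0 : 0 < t := div_pos h0 hν₀
  have ht2 : t ≤ 1 / 2 := by rw [ht, div_le_iff₀ hν₀]; linarith
  have htν : t * ν τ₀ = ν τ := div_mul_cancel₀ _ hν₀.ne'
  -- Although `G` may be indefinite, the operator is a convex combination of `Q` and the fixed
  -- positive definite `H₀`, with weight `t = ν τ / ν τ₀` on `H₀`.
  have e : ∀ v, (Q + ν τ • G) v = t • H₀ v + (1 - t) • Q v := fun v => by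
    simp only [hH₀, add_apply, smul_apply, ← htν]
    module
  refine ⟨fun v => ?_, fun x z hxz => ?_⟩
  · rw [e, inner_add_right, real_inner_smul_right, real_inner_smul_right]
    have h2 := mul_le_mul_of_nonneg_left (hc v) ht0.le
    have h3 : c₀ / ν τ₀ * ν τ * ‖v‖ ^ 2 = t * (c₀ * ‖v‖ ^ 2) := by rw [ht]; ring
    have h4 := hQ v
    nlinarith
  · exact norm_le_of_interpolation_eq hc₀ hc hQ ht0 ht2 (by rw [← e, hxz])

end Regularisation

/-! ### Bounds for `H_ν` and its inverse. -/

namespace LocalData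

variable {n p : ℕ} {L : LocalData n p} {M : GLIP n p} {xs : Euc p} {r : ℝ → ℝ}

theorem Hnu_apply (τ : ℝ) (v : Euc p) : Hnu M xs τ v
    = M.A.adjoint (hess (M.f M.yexact) (M.A xs) (M.A v)) + M.nu τ • hess M.g xs v := rfl

theorem inner_Hnu (τ : ℝ) (v : Euc p) : inner ℝ v (Hnu M xs τ v)
    = inner ℝ (M.A v) (hess (M.f M.yexact) (M.A xs) (M.A v))
      + M.nu τ * inner ℝ v (hess M.g xs v) := by
  rw [Hnu_apply, inner_add_right, ContinuousLinearMap.adjoint_inner_right, real_inner_smul_right]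

theorem isSymmetric_adjoint_comp {T : Euc n →L[ℝ] Euc n} (hT : T.IsSymmetric)
    (A : Euc p →L[ℝ] Euc n) : (A.adjoint ∘L T ∘L A).IsSymmetric := fun u v => by
  have h := hT (A u) (A v)
  simp only [ContinuousLinearMap.coe_coe, ContinuousLinearMap.comp_apply,
    ContinuousLinearMap.adjoint_inner_left, ContinuousLinearMap.adjoint_inner_right] at h ⊢
  exact h

theorem isSymmetric_Hnu (hf : ContDiffAt ℝ 2 (M.f M.yexact) (M.A xs))
    (hg : ContDiffAt ℝ 2 M.g xs) (τ : ℝ) : (Hnu M xs τ).IsSymmetric := fun u v => by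
  have h1 := isSymmetric_adjoint_comp (isSymmetric_hess hf) M.A u v
  have h2 := isSymmetric_hess hg u v
  simp only [ContinuousLinearMap.coe_coe] at h1 h2 ⊢
  simp only [Hnu, add_apply, smul_apply, inner_add_left, inner_add_right, real_inner_smul_left,
    real_inner_smul_right, h1, h2]

theorem isUnit_Hnu {τ : ℝ} (hH : ∀ v : Euc p, v ≠ 0 → 0 < inner ℝ v (Hnu M xs τ v)) :
    IsUnit (Hnu M xs τ) := by
  rw [ContinuousLinearMap.isUnit_iff_bijective]
  have hinj : Function.Injective (Hnu M xs τ) := by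
    rw [injective_iff_map_eq_zero]
    intro v hv
    by_contra hne
    have := hH v hne
    simp [hv] at this
  exact ⟨hinj, LinearMap.surjective_of_injective (f := (Hnu M xs τ).toLinearMap) hinj⟩

theorem HnuInv_Hnu {τ : ℝ} (hH : ∀ v : Euc p, v ≠ 0 → 0 < inner ℝ v (Hnu M xs τ v)) (v : Euc p) :
    HnuInv M xs τ (Hnu M xs τ v) = v :=
  congrArg (fun T => T v) (Ring.inverse_mul_cancel _ (isUnit_Hnu hH))

theorem Hnu_HnuInv {τ : ℝ} (hH : ∀ v : Euc p, v ≠ 0 → 0 < inner ℝ v (Hnu M xs τ v)) (v : Euc p) :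
    Hnu M xs τ (HnuInv M xs τ v) = v :=
  congrArg (fun T => T v) (Ring.mul_inverse_cancel _ (isUnit_Hnu hH))

theorem DeltaAssumptions.eventually_pos (hδ : L.DeltaAssumptions M xs r) :
    ∀ᶠ τ in 𝓝[>] (0 : ℝ), 0 < L.δ τ := by
  filter_upwards [hδ.div_sqrt.eventually_gt_atTop 0, self_mem_nhdsWithin] with τ h1 h2
  have : 0 < Real.sqrt τ := Real.sqrt_pos.2 h2
  exact (div_pos_iff_of_pos_right this).1 h1

theorem DeltaAssumptions.tendsto_add (hδ : L.DeltaAssumptions M xs r) :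
    Tendsto (fun τ => r τ + M.nu τ) (𝓝[>] 0) (𝓝 0) := by
  have h := hδ.dominates.mul hδ.tendsto_zero
  rw [mul_zero] at h
  refine h.congr' ?_
  filter_upwards [hδ.eventually_pos] with τ hτ
  exact div_mul_cancel₀ _ hτ.ne'

theorem eventually_nu_pos (hM : M.IsModel) : ∀ᶠ τ in 𝓝[>] (0 : ℝ), 0 < M.nu τ := by
  filter_upwards [self_mem_nhdsWithin] with τ hτ using hM.nu_pos τ hτ

theorem DeltaAssumptions.tendsto_nu (hδ : L.DeltaAssumptions M xs r) (hM : M.IsModel)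
    (hr : ∀ τ, 0 ≤ r τ) : Tendsto M.nu (𝓝[>] 0) (𝓝 0) := by
  refine tendsto_of_tendsto_of_tendsto_of_le_of_le' tendsto_const_nhds hδ.tendsto_add ?_ ?_
  · filter_upwards [eventually_nu_pos hM] with τ h using h.le
  · exact Eventually.of_forall fun τ => by have := hr τ; linarith

theorem DeltaAssumptions.tendsto_r (hδ : L.DeltaAssumptions M xs r) (hM : M.IsModel)
    (hr : ∀ τ, 0 ≤ r τ) : Tendsto r (𝓝[>] 0) (𝓝 0) := by
  refine tendsto_of_tendsto_of_tendsto_of_le_of_le' tendsto_const_nhds hδ.tendsto_add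
    (Eventually.of_forall hr) ?_
  filter_upwards [eventually_nu_pos hM] with τ h
  linarith

theorem SmoothInX.contDiffAt_g (hs : L.SmoothInX M xs r) (hδ : L.DeltaAssumptions M xs r) :
    ContDiffAt ℝ 2 M.g xs := by
  obtain ⟨τ, h1, h2⟩ := (hs.contDiff_g.and hδ.eventually_pos).exists
  exact h1 xs (Metric.mem_closedBall_self h2.le)

/-- Lower bounds of `H_ν`: `δ` is large compared with the posterior standard deviations. -/
theorem exists_lowerBound_Hnu (hM : M.IsModel) (hr : ∀ τ, 0 ≤ r τ)
    (hδ : L.DeltaAssumptions M xs r)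
    (hV : ∀ v : Euc p, M.A v ≠ 0 →
      0 < inner ℝ (M.A v) (hess (M.f M.yexact) (M.A xs) (M.A v)))
    (hH : ∀ᶠ τ in 𝓝[>] (0 : ℝ), ∀ v : Euc p, v ≠ 0 → 0 < inner ℝ v (Hnu M xs τ v)) :
    ∃ m : ℝ → ℝ, (∀ᶠ τ in 𝓝[>] (0 : ℝ), 0 < m τ ∧
      ∀ v, m τ * ‖v‖ ^ 2 ≤ inner ℝ v (Hnu M xs τ v)) ∧
      Tendsto (fun τ => L.δ τ * Real.sqrt (m τ / τ)) (𝓝[>] 0) atTop := by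
  set Q := M.A.adjoint ∘L hess (M.f M.yexact) (M.A xs) ∘L M.A
  have hQe : ∀ v, inner ℝ v (Q v) = inner ℝ (M.A v) (hess (M.f M.yexact) (M.A xs) (M.A v)) :=
    fun v => by simp [Q, ContinuousLinearMap.adjoint_inner_right]
  have hQ : ∀ v, 0 ≤ inner ℝ v (Q v) := fun v => by
    rw [hQe]
    by_cases h : M.A v = 0
    · simp [h]
    · exact (hV v h).le
  have hνpos := eventually_nu_pos hM
  obtain ⟨c, hc, K, -, hcK⟩ := exists_coercive_of_regularised (Q := Q) (G := hess M.g xs) hQ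
    (hδ.tendsto_nu hM hr) hνpos hH
  -- If `A` is injective, `Q` is coercive and `m` can be constant, so `δ / √τ → ∞` suffices.
  -- Otherwise `m = c ν` and `√(m / τ) = √c / γ`, which is where `δ / γ → ∞` is needed.
  by_cases hinj : Function.Injective M.A
  · obtain ⟨c₁, hc₁, hQ₁⟩ := ContinuousLinearMap.exists_pos_mul_sq_le_inner (T := Q) fun v hv => by
      rw [hQe]
      exact hV v fun h => hv (hinj (by simpa using h))
    refine ⟨fun _ => c₁ / 2, ?_, ?_⟩
    · filter_upwards [hcK, hνpos] with τ h1 h2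
      refine ⟨by positivity, fun v => ?_⟩
      have h3 := h1.1 v
      have h4 := hQ₁ v
      have h5 : 0 ≤ c * M.nu τ * ‖v‖ ^ 2 := by positivity
      change _ ≤ inner ℝ v ((Q + M.nu τ • hess M.g xs) v)
      linarith
    · have := hδ.div_sqrt.const_mul_atTop (Real.sqrt_pos.2 (half_pos hc₁))
      refine this.congr fun τ => ?_
      rw [Real.sqrt_div (half_pos hc₁).le τ]
      ring
  · refine ⟨fun τ => c * M.nu τ, ?_, ?_⟩
    · filter_upwards [hcK, hνpos] with τ h1 h2
      refine ⟨by positivity, fun v => ?_⟩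
      have h3 := h1.1 v
      have h4 := hQ v
      change _ ≤ inner ℝ v ((Q + M.nu τ • hess M.g xs) v)
      linarith
    · have := (hδ.div_gam hinj).const_mul_atTop (Real.sqrt_pos.2 hc)
      refine this.congr' ?_
      filter_upwards [hνpos, self_mem_nhdsWithin] with τ h1 h2
      rw [mul_div_assoc, Real.sqrt_mul hc.le, GLIP.gam, ← inv_div τ, Real.sqrt_inv]
      ring

/-- Upper bounds of `H_ν` and, on the relevant subspaces, of its inverse. -/
theorem exists_upperBound_HnuInv (hM : M.IsModel) (hr : ∀ τ, 0 ≤ r τ)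
    (hxs : M.IsLimitPoint xs) (hint : xs ∈ interior M.X)
    (hsm : L.SmoothInX M xs r) (hδ : L.DeltaAssumptions M xs r)
    (hV : ∀ v : Euc p, M.A v ≠ 0 →
      0 < inner ℝ (M.A v) (hess (M.f M.yexact) (M.A xs) (M.A v)))
    (hH : ∀ᶠ τ in 𝓝[>] (0 : ℝ), ∀ v : Euc p, v ≠ 0 → 0 < inner ℝ v (Hnu M xs τ v)) :
    ∃ K : ℝ, 0 ≤ K ∧ ∀ᶠ τ in 𝓝[>] (0 : ℝ),
      ‖HnuInv M xs τ ∘L M.A.adjoint‖ ≤ K ∧ M.nu τ * ‖HnuInv M xs τ‖ ≤ K ∧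
      ‖HnuInv M xs τ (gradient M.g xs)‖ ≤ K ∧ ‖Hnu M xs τ‖ ≤ K := by
  set Q := M.A.adjoint ∘L hess (M.f M.yexact) (M.A xs) ∘L M.A
  have hQe : ∀ v, inner ℝ v (Q v) = inner ℝ (M.A v) (hess (M.f M.yexact) (M.A xs) (M.A v)) :=
    fun v => by simp [Q, ContinuousLinearMap.adjoint_inner_right]
  have hQ : ∀ v, 0 ≤ inner ℝ v (Q v) := fun v => by
    rw [hQe]
    by_cases h : M.A v = 0
    · simp [h]
    · exact (hV v h).le
  have hQs : Q.IsSymmetric := isSymmetric_adjoint_comp (isSymmetric_hess hsm.contDiff_f_exact) M.A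
  have hker : ∀ v, Q v = 0 → M.A v = 0 := fun v hv => by
    by_contra h
    have := hV v h
    rw [← hQe, hv] at this
    simp at this
  have hνpos := eventually_nu_pos hM
  obtain ⟨c, hc, K, hK, hcK⟩ := exists_coercive_of_regularised (Q := Q) (G := hess M.g xs) hQ
    (hδ.tendsto_nu hM hr) hνpos hH
  -- `Q` and `A` have the same kernel by nondegeneracy, so whatever is orthogonal to the kernel of
  -- `A` is in the range of `Q`. This covers `∇g(xs)` and all vectors `Aᵀ w`.
  obtain ⟨zg, hzg⟩ := exists_apply_eq_of_orthogonal_ker hQs (w := gradient M.g xs) fun v hv =>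
    hxs.inner_gradient_eq_zero hint (hsm.contDiffAt_g hδ) (hker v hv)
  have hrange : ∀ w, ∃ z, Q z = M.A.adjoint w := fun w =>
    exists_apply_eq_of_orthogonal_ker hQs fun v hv => by
      rw [ContinuousLinearMap.adjoint_inner_right, hker v hv, inner_zero_left]
  -- Choosing the preimages linearly in `w` bounds them by a multiple of `‖w‖`.
  obtain ⟨Z, hZ⟩ : ∃ Z : Euc n →ₗ[ℝ] Euc p, ∀ w, Q (Z w) = M.A.adjoint w := by
    set b := (EuclideanSpace.basisFun (Fin n) ℝ).toBasis
    choose z hz using hrange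
    refine ⟨b.constr ℝ fun i => z (b i), fun w => ?_⟩
    have : Q.toLinearMap ∘ₗ b.constr ℝ (fun i => z (b i)) = M.A.adjoint.toLinearMap :=
      b.ext fun i => by simp [hz]
    exact congrArg (fun T => T w) this
  set Z' := LinearMap.toContinuousLinearMap Z
  have hnuB := (hδ.tendsto_nu hM hr).eventually (gt_mem_nhds one_pos)
  refine ⟨max (max (K * ‖Z'‖) c⁻¹) (max (K * ‖zg‖) (‖Q‖ + ‖hess M.g xs‖)),
    le_max_of_le_left (le_max_of_le_left (by positivity)), ?_⟩
  filter_upwards [hcK, hνpos, hH, hnuB] with τ h1 hν hpos hν1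
  refine ⟨le_max_of_le_left (le_max_of_le_left ?_), le_max_of_le_left (le_max_of_le_right ?_),
    le_max_of_le_right (le_max_of_le_left ?_), le_max_of_le_right (le_max_of_le_right ?_)⟩
  · refine ContinuousLinearMap.opNorm_le_bound _ (by positivity) fun w => ?_
    refine (h1.2 _ (Z w) ?_).trans ?_
    · exact (Hnu_HnuInv hpos _).trans (hZ w).symm
    · rw [mul_assoc]
      exact mul_le_mul_of_nonneg_left (Z'.le_opNorm w) hK
  · rw [mul_comm, ← le_div_iff₀ hν]
    refine ContinuousLinearMap.opNorm_le_bound _ (by positivity) fun w => ?_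
    have h2 := norm_le_of_inner_bound (H := Hnu M xs τ) (c := c * M.nu τ) (fun v => by
      have h3 := h1.1 v
      have h4 := hQ v
      change _ ≤ inner ℝ v ((Q + M.nu τ • hess M.g xs) v)
      linarith) (HnuInv M xs τ w)
    rw [Hnu_HnuInv hpos] at h2
    rw [div_eq_mul_inv, ← mul_inv, inv_mul_eq_div, le_div_iff₀ (by positivity)]
    linarith
  · exact h1.2 _ _ ((Hnu_HnuInv hpos _).trans hzg.symm)
  · calc ‖Q + M.nu τ • hess M.g xs‖ ≤ ‖Q‖ + ‖M.nu τ • hess M.g xs‖ := norm_add_le _ _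
      _ ≤ ‖Q‖ + 1 * ‖hess M.g xs‖ := by
        rw [norm_smul, Real.norm_of_nonneg hν.le]
        gcongr
      _ = _ := by rw [one_mul]

end LocalData

/-! ### Orders of magnitude and limits of the constants. -/

namespace LocalData

section GaussBall

theorem integral_exp_neg_sq_norm_div_two (p : ℕ) :
    ∫ x : Euc p, Real.exp (-‖x‖ ^ 2 / 2) = (2 * Real.pi) ^ ((p : ℝ) / 2) := by
  have h := GaussianFourier.integral_rexp_neg_mul_sq_norm (V := Euc p) (b := 1 / 2) (by norm_num)
  rw [finrank_euclideanSpace_fin] at h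
  rw [show 2 * Real.pi = Real.pi / (1 / 2) by ring, ← h]
  congr 1 with x
  ring_nf

theorem integrable_exp_neg_sq_norm_div_two (p : ℕ) :
    Integrable fun x : Euc p => Real.exp (-‖x‖ ^ 2 / 2) := by
  have h := integrable_exp_neg_mul_sq_norm (E := Euc p) (b := 1 / 2) (by norm_num)
  refine h.congr (Eventually.of_forall fun x => ?_)
  simp only
  ring_nf

theorem gaussBall_le_one (p : ℕ) (R : ℝ) : gaussBall p R ≤ 1 := by
  have h : ∫ x in Metric.closedBall (0 : Euc p) R, Real.exp (-‖x‖ ^ 2 / 2)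
      ≤ (2 * Real.pi) ^ ((p : ℝ) / 2) := by
    rw [← integral_exp_neg_sq_norm_div_two]
    exact setIntegral_le_integral (integrable_exp_neg_sq_norm_div_two p)
      (Eventually.of_forall fun x => (Real.exp_pos _).le)
  rw [gaussBall, neg_div, Real.rpow_neg (by positivity)]
  rwa [inv_mul_le_iff₀ (by positivity), mul_one]

theorem tendsto_gaussBall (p : ℕ) : Tendsto (gaussBall p) atTop (𝓝 1) := by
  have h := ((aecover_closedBall (μ := (volume : Measure (Euc p))) (x := 0)
    tendsto_id).integral_tendsto_of_countably_generated
      (integrable_exp_neg_sq_norm_div_two p)).const_mul ((2 * Real.pi) ^ (-(p : ℝ) / 2))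
  rw [integral_exp_neg_sq_norm_div_two, ← Real.rpow_add (by positivity)] at h
  convert! h using 2
  rw [neg_div, neg_add_cancel, Real.rpow_zero]

/-- In dimension zero the sphere is empty, so `lamMin` takes the default value `0` and `R⋆ = 0` does
not tend to infinity; the ball still has full measure. -/
theorem gaussBall_zero_dim {R : ℝ} (hR : 0 ≤ R) : gaussBall 0 R = 1 := by
  have h := integral_exp_neg_sq_norm_div_two 0
  have e : Metric.closedBall (0 : Euc 0) R = univ := by
    ext x
    simp [Subsingleton.elim x 0, hR]
  rw [gaussBall, e, setIntegral_univ, h]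
  simp

end GaussBall

variable {n p : ℕ} {L : LocalData n p} {M : GLIP n p} {xs : Euc p} {r : ℝ → ℝ}

/-- The operator `δ D + r Aᵀ M_{f,2} A` that dominates the variation of the Hessian. -/
def hessVar (L : LocalData n p) (M : GLIP n p) (τ ρ : ℝ) : Euc p →L[ℝ] Euc p :=
  L.δ τ • L.D M τ + ρ • (M.A.adjoint ∘L L.Mf2 ∘L M.A)

theorem isPositive_Mf2 (hS : L.Mf2sqrt.IsPositive) : L.Mf2.IsPositive := by
  have := ContinuousLinearMap.isPositive_adjoint_comp_self L.Mf2sqrt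
  rwa [hS.isSelfAdjoint.adjoint_eq] at this

theorem isPositive_hessVar {τ ρ : ℝ} (hf : (L.Cf τ).IsPositive) (hg : (L.Cg τ).IsPositive)
    (hS : L.Mf2sqrt.IsPositive) (hδ : 0 ≤ L.δ τ) (hν : 0 ≤ M.nu τ) (hρ : 0 ≤ ρ) :
    (L.hessVar M τ ρ).IsPositive := by
  have h1 := hf.adjoint_conj M.A
  have h2 := (isPositive_Mf2 hS).adjoint_conj M.A
  exact (((h1.smul_of_nonneg (norm_nonneg M.A)).add (hg.smul_of_nonneg hν)).smul_of_nonneg hδ).add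
    (h2.smul_of_nonneg hρ)

theorem norm_HnuInv_comp_hessVar_le {τ ρ : ℝ} (hδ : 0 ≤ L.δ τ) (hρ : 0 ≤ ρ) :
    ‖HnuInv M xs τ ∘L L.hessVar M τ ρ‖ ≤ L.lamTilde M xs τ ρ := by
  rw [hessVar, ContinuousLinearMap.comp_add, ContinuousLinearMap.comp_smul,
    ContinuousLinearMap.comp_smul]
  refine (norm_add_le _ _).trans_eq ?_
  rw [norm_smul, norm_smul, Real.norm_of_nonneg hδ, Real.norm_of_nonneg hρ, lamTilde]

theorem lamTilde_nonneg {τ ρ : ℝ} (hδ : 0 ≤ L.δ τ) (hρ : 0 ≤ ρ) :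
    0 ≤ L.lamTilde M xs τ ρ := by
  unfold lamTilde; positivity

theorem bias_nonneg {τ ρ : ℝ} (hl : L.lamTilde M xs τ ρ ≤ 1) (hρ : 0 ≤ ρ) (hν : 0 ≤ M.nu τ) :
    0 ≤ L.bias M xs τ ρ := by
  have : 0 ≤ 1 - L.lamTilde M xs τ ρ := by linarith
  unfold bias cbar1 cbar2
  positivity

/-- Orders of magnitude of the constants: `‖D‖` is bounded, `λ̃ = O(δ + r)`, and the bias
is `O(r + ν)`. -/
theorem exists_bounds (hM : M.IsModel) (hr : ∀ τ, 0 ≤ r τ)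
    (hxs : M.IsLimitPoint xs) (hint : xs ∈ interior M.X)
    (hsm : L.SmoothInX M xs r) (hδ : L.DeltaAssumptions M xs r)
    (hV : ∀ v : Euc p, M.A v ≠ 0 →
      0 < inner ℝ (M.A v) (hess (M.f M.yexact) (M.A xs) (M.A v)))
    (hH : ∀ᶠ τ in 𝓝[>] (0 : ℝ), ∀ v : Euc p, v ≠ 0 → 0 < inner ℝ v (Hnu M xs τ v)) :
    ∃ K : ℝ, 0 < K ∧ ∀ᶠ τ in 𝓝[>] (0 : ℝ), ‖L.D M τ‖ ≤ K ∧ ‖Hnu M xs τ‖ ≤ K ∧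
      L.lamTilde M xs τ (r τ) ≤ K * (L.δ τ + r τ) ∧ L.lamTilde M xs τ (r τ) ≤ 1 / 2 ∧
      L.bias M xs τ (r τ) ≤ K * (r τ + M.nu τ) := by
  obtain ⟨K, hK, hKb⟩ := exists_upperBound_HnuInv hM hr hxs hint hsm hδ hV hH
  obtain ⟨C, hC⟩ := hsm.bounded
  set KD := K * C * ‖M.A‖ * ‖M.A‖ + K * C
  set KS := K * ‖L.Mf2‖ * ‖M.A‖
  set Kb := 2 * (K * ‖L.Mf1‖) + 2 * K
  set KN := ‖M.A‖ * (‖M.A‖ * (C * ‖M.A‖)) + C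
  set K' := |KD| + |KS| + Kb + |KN| + K + 1
  have hKb0 : 0 ≤ Kb := by positivity
  have hK' : 0 < K' := by positivity
  have hsum : Tendsto (fun τ => K' * (L.δ τ + r τ)) (𝓝[>] 0) (𝓝 0) := by
    simpa using (hδ.tendsto_zero.add (hδ.tendsto_r hM hr)).const_mul K'
  have key : ∀ᶠ τ in 𝓝[>] (0 : ℝ), ‖L.D M τ‖ ≤ K' ∧ ‖Hnu M xs τ‖ ≤ K' ∧
      L.lamTilde M xs τ (r τ) ≤ K' * (L.δ τ + r τ) := by
    filter_upwards [hKb, hC, eventually_nu_pos hM, hδ.eventually_pos,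
      (hδ.tendsto_nu hM hr).eventually (gt_mem_nhds one_pos)]
      with τ ⟨k1, k2, k3, k4⟩ ⟨c1, c2⟩ hν hδ0 hν1
    have hC0 : 0 ≤ C := (norm_nonneg _).trans c1
    have hrτ := hr τ
    have a1 := le_abs_self KD
    have a2 := le_abs_self KS
    have a3 := le_abs_self KN
    have a4 := abs_nonneg KD
    have a5 := abs_nonneg KS
    have a6 := abs_nonneg KN
    refine ⟨?_, by simp only [K']; linarith, ?_⟩
    · have : ‖L.D M τ‖ ≤ KN := by
        refine (norm_add_le _ _).trans (add_le_add ?_ ?_)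
        · rw [norm_smul, norm_norm]
          gcongr
          refine (ContinuousLinearMap.opNorm_comp_le _ _).trans ?_
          rw [LinearIsometryEquiv.norm_map]
          gcongr
          exact (ContinuousLinearMap.opNorm_comp_le _ _).trans (by gcongr)
        · rw [norm_smul, Real.norm_of_nonneg hν.le]
          nlinarith [norm_nonneg (L.Cg τ)]
      simp only [K']; linarith
    · have h1 : ‖HnuInv M xs τ ∘L L.D M τ‖ ≤ KD := by
        -- The inverse occurs only next to `Aᵀ` or with a factor `ν`, and both combinations are
        -- bounded.
        have e : HnuInv M xs τ ∘L L.D M τ = ‖M.A‖ • ((HnuInv M xs τ ∘L M.A.adjoint) ∘L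
            (L.Cf τ ∘L M.A)) + M.nu τ • (HnuInv M xs τ ∘L L.Cg τ) := by
          ext1 v
          simp [D]
        rw [e]
        refine (norm_add_le _ _).trans (add_le_add ?_ ?_)
        · rw [norm_smul, norm_norm]
          calc _ ≤ ‖M.A‖ * (K * (C * ‖M.A‖)) := by
                gcongr
                refine (ContinuousLinearMap.opNorm_comp_le _ _).trans ?_
                gcongr
                exact (ContinuousLinearMap.opNorm_comp_le _ _).trans (by gcongr)
            _ = _ := by ring
        · rw [norm_smul, Real.norm_of_nonneg hν.le]
          calc _ ≤ M.nu τ * (‖HnuInv M xs τ‖ * ‖L.Cg τ‖) := by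
                gcongr
                exact ContinuousLinearMap.opNorm_comp_le _ _
            _ = M.nu τ * ‖HnuInv M xs τ‖ * ‖L.Cg τ‖ := by ring
            _ ≤ _ := by gcongr
      have h2 : ‖HnuInv M xs τ ∘L M.A.adjoint ∘L L.Mf2 ∘L M.A‖ ≤ KS := by
        rw [← ContinuousLinearMap.comp_assoc]
        calc _ ≤ K * (‖L.Mf2‖ * ‖M.A‖) := by
              refine (ContinuousLinearMap.opNorm_comp_le _ _).trans ?_
              gcongr
              exact ContinuousLinearMap.opNorm_comp_le _ _
          _ = _ := by simp only [KS]; ring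
      rw [lamTilde, mul_add, mul_comm K', mul_comm K']
      refine add_le_add (mul_le_mul_of_nonneg_left ?_ hδ0.le) (mul_le_mul_of_nonneg_left ?_ hrτ)
      · simp only [K']; linarith
      · simp only [K']; linarith
  refine ⟨K', hK', ?_⟩
  filter_upwards [key, hKb, eventually_nu_pos hM, hsum.eventually (gt_mem_nhds one_half_pos)]
    with τ ⟨d1, d2, d3⟩ ⟨k1, k2, k3, k4⟩ hν hl
  have hl2 : L.lamTilde M xs τ (r τ) ≤ 1 / 2 := d3.trans hl.le
  refine ⟨d1, d2, d3, hl2, ?_⟩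
  have hrτ := hr τ
  have hbd : ∀ a b : ℝ, 0 ≤ a → a ≤ b → a / (1 - L.lamTilde M xs τ (r τ)) ≤ 2 * b :=
    fun a b h0 h => by
      rw [div_le_iff₀ (by linarith)]
      nlinarith
  have b1 : L.cbar1 M xs τ (r τ) ≤ 2 * (K * ‖L.Mf1‖) := hbd _ _ (norm_nonneg _) (by
    rw [← ContinuousLinearMap.comp_assoc]
    exact (ContinuousLinearMap.opNorm_comp_le _ _).trans (by gcongr))
  have b2 : L.cbar2 M xs τ (r τ) ≤ 2 * K := hbd _ _ (norm_nonneg _) k3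
  have a4 := abs_nonneg KD
  have a5 := abs_nonneg KS
  have a6 := abs_nonneg KN
  have a7 : 0 ≤ K * ‖L.Mf1‖ := by positivity
  rw [bias, mul_add]
  refine add_le_add (mul_le_mul_of_nonneg_right ?_ hrτ) (mul_le_mul_of_nonneg_right ?_ hν.le)
  · simp only [K', Kb]; linarith
  · simp only [K', Kb]; linarith

end LocalData

namespace GLIP

variable {n p : ℕ} (M : GLIP n p)

theorem Delta0_nonneg (xs : Euc p) (δ τ : ℝ) (y : Euc n) : 0 ≤ M.Delta0 xs δ τ y :=
  div_nonneg (integral_nonneg fun _ => (Real.exp_pos _).le)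
    (integral_nonneg fun _ => (Real.exp_pos _).le)

theorem Delta0Sup_nonneg (xs : Euc p) (δ τ r : ℝ) : 0 ≤ M.Delta0Sup xs δ τ r :=
  Real.iSup_nonneg fun _ => M.Delta0_nonneg xs δ τ _

end GLIP

namespace LocalData

variable {n p : ℕ} {L : LocalData n p} {M : GLIP n p} {xs : Euc p} {r : ℝ → ℝ}

theorem DeltaAssumptions.tendsto_Delta0Sup (hδ : L.DeltaAssumptions M xs r) :
    Tendsto (fun τ => M.Delta0Sup xs (L.δ τ) τ (r τ)) (𝓝[>] 0) (𝓝 0) := by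
  rw [Metric.tendsto_nhds]
  intro ε hε
  filter_upwards [hδ.Delta0_small (ε / 2) (half_pos hε)] with τ hτ
  rw [Real.dist_0_eq_abs, abs_of_nonneg (M.Delta0Sup_nonneg _ _ _ _)]
  have : M.Delta0Sup xs (L.δ τ) τ (r τ) ≤ ε / 2 :=
    Real.iSup_le (fun y => hτ y y.2) (half_pos hε).le
  linarith

theorem DeltaAssumptions.eventually_Delta0_le (hδ : L.DeltaAssumptions M xs r) :
    ∀ᶠ τ in 𝓝[>] (0 : ℝ), ∀ y ∈ M.yLoc τ (r τ),
      M.Delta0 xs (L.δ τ) τ y ≤ M.Delta0Sup xs (L.δ τ) τ (r τ) := by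
  filter_upwards [hδ.Delta0_small 1 one_pos] with τ hτ y hy
  refine le_ciSup (f := fun y : M.yLoc τ (r τ) => M.Delta0 xs (L.δ τ) τ y) ⟨1, ?_⟩ ⟨y, hy⟩
  rintro _ ⟨z, rfl⟩
  exact hτ z z.2

/-- The orders of magnitude of the constants, as established by `exists_bounds` and
`exists_lowerBound_Hnu`. -/
structure Orders (L : LocalData n p) (M : GLIP n p) (xs : Euc p) (r : ℝ → ℝ) (K : ℝ)
    (m : ℝ → ℝ) : Prop where
  K_pos : 0 < K
  upper : ∀ᶠ τ in 𝓝[>] (0 : ℝ), ‖L.D M τ‖ ≤ K ∧ ‖Hnu M xs τ‖ ≤ K ∧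
      L.lamTilde M xs τ (r τ) ≤ K * (L.δ τ + r τ) ∧ L.lamTilde M xs τ (r τ) ≤ 1 / 2 ∧
      L.bias M xs τ (r τ) ≤ K * (r τ + M.nu τ)
  lower : ∀ᶠ τ in 𝓝[>] (0 : ℝ), 0 < m τ ∧ ∀ v, m τ * ‖v‖ ^ 2 ≤ inner ℝ v (Hnu M xs τ v)
  tendsto_lower : Tendsto (fun τ => L.δ τ * Real.sqrt (m τ / τ)) (𝓝[>] 0) atTop
  nonneg_r : ∀ τ, 0 ≤ r τ
  delta : L.DeltaAssumptions M xs r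
  nu_pos : ∀ᶠ τ in 𝓝[>] (0 : ℝ), 0 < M.nu τ
  tendsto_r : Tendsto r (𝓝[>] 0) (𝓝 0)

namespace Orders

variable {K : ℝ} {m : ℝ → ℝ} (h : Orders L M xs r K m)
include h

theorem tendsto_lamTilde : Tendsto (fun τ => L.lamTilde M xs τ (r τ)) (𝓝[>] 0) (𝓝 0) := by
  have hsum : Tendsto (fun τ => K * (L.δ τ + r τ)) (𝓝[>] 0) (𝓝 0) := by
    simpa using (h.delta.tendsto_zero.add h.tendsto_r).const_mul K
  refine tendsto_of_tendsto_of_tendsto_of_le_of_le' tendsto_const_nhds hsum ?_ ?_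
  · filter_upwards [h.delta.eventually_pos] with τ hτ
    exact lamTilde_nonneg hτ.le (h.nonneg_r τ)
  · filter_upwards [h.upper] with τ hτ using hτ.2.2.1

theorem eventually_bias_nonneg : ∀ᶠ τ in 𝓝[>] (0 : ℝ), 0 ≤ L.bias M xs τ (r τ) := by
  filter_upwards [h.upper, h.nu_pos] with τ h1 h2
  exact bias_nonneg (by linarith [h1.2.2.2.1]) (h.nonneg_r τ) h2.le

theorem eventually_bias_le : ∀ᶠ τ in 𝓝[>] (0 : ℝ), L.bias M xs τ (r τ) ≤ L.δ τ / 2 := by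
  have h1 := (h.delta.dominates.const_mul K)
  rw [mul_zero] at h1
  filter_upwards [h.upper, h1.eventually (gt_mem_nhds one_half_pos), h.delta.eventually_pos]
    with τ h2 h3 h4
  rw [← mul_div_assoc, div_lt_iff₀ h4] at h3
  linarith [h2.2.2.2.2]

theorem tendsto_delta_mul_bias_sq :
    Tendsto (fun τ => L.δ τ * L.bias M xs τ (r τ) ^ 2 / τ) (𝓝[>] 0) (𝓝 0) := by
  have h1 := h.delta.localQuad.const_mul (K ^ 2)
  rw [mul_zero] at h1
  refine tendsto_of_tendsto_of_tendsto_of_le_of_le' tendsto_const_nhds h1 ?_ ?_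
  · filter_upwards [h.delta.eventually_pos, self_mem_nhdsWithin] with τ hτ (h0 : 0 < τ)
    positivity
  · filter_upwards [h.delta.eventually_pos, self_mem_nhdsWithin, h.upper,
      h.eventually_bias_nonneg] with τ hτ (h0 : 0 < τ) h2 h3
    rw [← mul_div_assoc]
    refine div_le_div_of_nonneg_right ?_ h0.le
    calc _ ≤ L.δ τ * (K * (r τ + M.nu τ)) ^ 2 := by gcongr; exact h2.2.2.2.2
      _ = _ := by ring

/-- Eventually `r ≤ δ`, hence `λ̃ ≤ 2 K δ`. This keeps the exponential prefactor of the Laplace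
comparison bounded. -/
theorem tendsto_lamTilde_mul_bias_sq :
    Tendsto (fun τ => L.lamTilde M xs τ (r τ) * L.bias M xs τ (r τ) ^ 2 / τ) (𝓝[>] 0) (𝓝 0) := by
  have h1 := h.tendsto_delta_mul_bias_sq.const_mul (2 * K)
  rw [mul_zero] at h1
  refine tendsto_of_tendsto_of_tendsto_of_le_of_le' tendsto_const_nhds h1 ?_ ?_
  · filter_upwards [h.delta.eventually_pos, self_mem_nhdsWithin] with τ hτ (h0 : 0 < τ)
    have := lamTilde_nonneg (M := M) (xs := xs) hτ.le (h.nonneg_r τ)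
    positivity
  · filter_upwards [h.delta.eventually_pos, self_mem_nhdsWithin, h.upper,
      h.delta.dominates.eventually (gt_mem_nhds one_pos), h.nu_pos] with τ hτ (h0 : 0 < τ) h2 h3 h4
    rw [div_lt_one hτ] at h3
    rw [← mul_div_assoc]
    refine div_le_div_of_nonneg_right ?_ h0.le
    rw [← mul_assoc]
    refine mul_le_mul_of_nonneg_right ?_ (sq_nonneg _)
    have := h.K_pos
    nlinarith [h2.2.2.1]

theorem tendsto_half_delta : Tendsto (fun τ => Real.sqrt (m τ / τ) * (L.δ τ / 2)) (𝓝[>] 0) atTop :=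
  (h.tendsto_lower.const_mul_atTop (one_half_pos (α := ℝ))).congr fun τ => by ring

theorem tendsto_Rstar (hp : 0 < p) :
    Tendsto (fun τ => L.Rstar M xs τ (r τ)) (𝓝[>] 0) atTop := by
  have h1 := h.tendsto_half_delta.const_mul_atTop (Real.sqrt_pos.2 (one_half_pos (α := ℝ)))
  refine tendsto_atTop_mono' _ ?_ h1
  filter_upwards [h.upper, h.lower, h.eventually_bias_le, h.delta.eventually_pos,
    self_mem_nhdsWithin] with τ h2 h3 h4 h5 (h6 : 0 < τ)
  have hm : m τ ≤ lamMin (Hnu M xs τ) := by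
    have : Nonempty (Fin p) := ⟨⟨0, hp⟩⟩
    refine le_csInf ((NormedSpace.sphere_nonempty.2 zero_le_one).image _) ?_
    rintro _ ⟨v, hv, rfl⟩
    have := norm_le_of_inner_bound h3.2 v
    rwa [mem_sphere_zero_iff_norm.1 hv, mul_one] at this
  rw [Rstar, ← mul_assoc, mul_comm (√(1 / 2))]
  gcongr
  · linarith [h2.2.2.2.1]
  · linarith

theorem tendsto_gaussBall_Rstar :
    Tendsto (fun τ => gaussBall p (L.Rstar M xs τ (r τ))) (𝓝[>] 0) (𝓝 1) := by
  rcases Nat.eq_zero_or_pos p with rfl | hp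
  · refine tendsto_const_nhds.congr' ?_
    filter_upwards [h.eventually_bias_le, h.delta.eventually_pos] with τ h1 h2
    rw [gaussBall_zero_dim]
    exact mul_nonneg (by positivity) (by linarith)
  · exact (tendsto_gaussBall p).comp (h.tendsto_Rstar hp)

theorem tendsto_DeltaStarK :
    Tendsto (fun τ => L.DeltaStarK M xs τ (r τ)) (𝓝[>] 0) (𝓝 0) := by
  have h1 : Tendsto (fun τ => L.δ τ * ‖L.D M τ‖ * L.bias M xs τ (r τ) ^ 2 / τ) (𝓝[>] 0)
      (𝓝 0) := by
    have h1 := h.tendsto_delta_mul_bias_sq.const_mul K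
    rw [mul_zero] at h1
    refine tendsto_of_tendsto_of_tendsto_of_le_of_le' tendsto_const_nhds h1 ?_ ?_
    · filter_upwards [h.delta.eventually_pos, self_mem_nhdsWithin] with τ hτ (h0 : 0 < τ)
      positivity
    · filter_upwards [h.delta.eventually_pos, self_mem_nhdsWithin, h.upper] with τ hτ (h0 : 0 < τ) h2
      rw [← mul_div_assoc, ← mul_assoc, mul_comm K]
      gcongr
      exact h2.1
  have h2 := (Real.continuous_exp.tendsto 0).comp h1
  have h3 : Tendsto (fun τ => ((1 + L.lamTilde M xs τ (r τ)) / (1 - L.lamTilde M xs τ (r τ)))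
      ^ ((p : ℝ) / 2)) (𝓝[>] 0) (𝓝 (((1 + 0) / (1 - 0)) ^ ((p : ℝ) / 2))) :=
    ((h.tendsto_lamTilde.const_add 1).div (h.tendsto_lamTilde.const_sub 1) (by norm_num)).rpow_const
      (Or.inl (by norm_num))
  have := (((((h2.div h.tendsto_gaussBall_Rstar one_ne_zero).mul h3).sub_const 1).add
    h.delta.tendsto_Delta0Sup).add h.tendsto_lamTilde)
  simp only [Real.exp_zero, add_zero, sub_zero, div_one, Real.one_rpow, mul_one, sub_self] at this
  exact this

/-- The exponential and the power in `Δ_{⋆,K}` are at least `1` and the Gaussian measure is at most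
`1`, so what is added to `λ̃` is nonnegative. The concentration estimate uses nothing else about
`Δ_{⋆,K}`. -/
theorem eventually_lamTilde_le_DeltaStarK : ∀ᶠ τ in 𝓝[>] (0 : ℝ),
    L.lamTilde M xs τ (r τ) ≤ L.DeltaStarK M xs τ (r τ) := by
  filter_upwards [h.delta.eventually_pos, self_mem_nhdsWithin, h.upper,
    h.tendsto_gaussBall_Rstar.eventually (lt_mem_nhds one_pos)] with τ h1 (h0 : 0 < τ) h2 h3
  have l0 := lamTilde_nonneg (M := M) (xs := xs) h1.le (h.nonneg_r τ)
  have l1 : L.lamTilde M xs τ (r τ) ≤ 1 / 2 := h2.2.2.2.1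
  have a1 : 1 ≤ Real.exp (L.δ τ * ‖L.D M τ‖ * L.bias M xs τ (r τ) ^ 2 / τ)
      / gaussBall p (L.Rstar M xs τ (r τ)) := by
    rw [one_le_div h3]
    exact (gaussBall_le_one p _).trans (Real.one_le_exp (by positivity))
  have a2 : 1 ≤ ((1 + L.lamTilde M xs τ (r τ)) / (1 - L.lamTilde M xs τ (r τ)))
      ^ ((p : ℝ) / 2) := by
    refine Real.one_le_rpow ?_ (by positivity)
    rw [one_le_div (by linarith)]
    linarith
  have a3 := M.Delta0Sup_nonneg xs (L.δ τ) τ (r τ)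
  have a4 := one_le_mul_of_one_le_of_one_le a1 a2
  unfold DeltaStarK
  linarith

theorem eventually_trace_le (hH : ∀ᶠ τ in 𝓝[>] (0 : ℝ), ∀ v : Euc p, v ≠ 0 →
    0 < inner ℝ v (Hnu M xs τ v)) :
    ∀ᶠ τ in 𝓝[>] (0 : ℝ), trHnuInv M xs τ ≤ p / m τ := by
  filter_upwards [h.lower, hH] with τ h1 h2
  refine (trace_le_finrank_mul_opNorm _).trans ?_
  rw [finrank_euclideanSpace_fin, div_eq_mul_inv]
  gcongr
  refine ContinuousLinearMap.opNorm_le_bound _ (inv_nonneg.2 h1.1.le) fun w => ?_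
  have := norm_le_of_inner_bound h1.2 (HnuInv M xs τ w)
  rw [Hnu_HnuInv h2] at this
  rw [inv_mul_eq_div, le_div_iff₀ h1.1]
  linarith

theorem tendsto_lower_sq : Tendsto (fun τ => m τ / τ * (L.δ τ / 2) ^ 2) (𝓝[>] 0) atTop := by
  have h1 := (tendsto_pow_atTop (two_ne_zero (α := ℕ))).comp h.tendsto_half_delta
  refine h1.congr' ?_
  filter_upwards [h.lower, self_mem_nhdsWithin] with τ h2 (h0 : 0 < τ)
  have := h2.1
  simp only [Function.comp, mul_pow]
  rw [Real.sq_sqrt (by positivity)]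

theorem tendsto_div_lower : Tendsto (fun τ => τ / m τ) (𝓝[>] 0) (𝓝 0) := by
  have h1 := h.tendsto_lower_sq.inv_tendsto_atTop.mul ((h.delta.tendsto_zero.div_const 2).pow 2)
  simp only [zero_div, ne_eq, OfNat.ofNat_ne_zero, not_false_eq_true, zero_pow, mul_zero] at h1
  refine h1.congr' ?_
  filter_upwards [h.lower, self_mem_nhdsWithin, h.delta.eventually_pos] with τ h2 (h0 : 0 < τ) h3
  have := h2.1
  simp only [Pi.inv_apply]
  field_simp

end Orders

theorem trHnuInv_pos (hp : 0 < p) {τ : ℝ} (hs : (Hnu M xs τ).IsSymmetric)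
    (hH : ∀ v : Euc p, v ≠ 0 → 0 < inner ℝ v (Hnu M xs τ v)) : 0 < trHnuInv M xs τ := by
  have : Nonempty (Fin p) := ⟨⟨0, hp⟩⟩
  obtain ⟨v, hv⟩ := exists_ne (0 : Euc p)
  have h1 := sq_norm_le_trace_mul_inner hs hH (HnuInv_Hnu hH) v
  have h2 : 0 < ‖v‖ ^ 2 := by have := norm_pos_iff.2 hv; positivity
  exact pos_of_mul_pos_left (h2.trans_le h1) (hH v hv).le

theorem trHnuInv_nonneg {τ : ℝ} (hs : (Hnu M xs τ).IsSymmetric)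
    (hH : ∀ v : Euc p, v ≠ 0 → 0 < inner ℝ v (Hnu M xs τ v)) : 0 ≤ trHnuInv M xs τ := by
  rcases Nat.eq_zero_or_pos p with rfl | hp
  · have : (HnuInv M xs τ).toLinearMap = 0 := LinearMap.ext fun v => Subsingleton.elim _ _
    rw [trHnuInv, this, map_zero]
  · exact (trHnuInv_pos hp hs hH).le

theorem Orders.tendsto_trace {K : ℝ} {m : ℝ → ℝ} (h : Orders L M xs r K m)
    (hs : ∀ τ, (Hnu M xs τ).IsSymmetric)
    (hH : ∀ᶠ τ in 𝓝[>] (0 : ℝ), ∀ v : Euc p, v ≠ 0 → 0 < inner ℝ v (Hnu M xs τ v)) :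
    Tendsto (fun τ => 4 * τ * trHnuInv M xs τ) (𝓝[>] 0) (𝓝 0) := by
  have h1 := h.tendsto_div_lower.const_mul (4 * (p : ℝ))
  rw [mul_zero] at h1
  refine tendsto_of_tendsto_of_tendsto_of_le_of_le' tendsto_const_nhds h1 ?_ ?_
  · filter_upwards [hH, self_mem_nhdsWithin] with τ h2 (h0 : 0 < τ)
    have := trHnuInv_nonneg (hs τ) h2
    positivity
  · filter_upwards [h.eventually_trace_le hH, self_mem_nhdsWithin] with τ h2 (h0 : 0 < τ)
    calc _ ≤ 4 * τ * (p / m τ) := by gcongr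
      _ = _ := by ring

/-- The Gaussian tail outside the ball of radius `δ` is negligible. -/
theorem Orders.eventually_tail_le {K : ℝ} {m : ℝ → ℝ} (h : Orders L M xs r K m) (hp : 0 < p)
    (hs : ∀ τ, (Hnu M xs τ).IsSymmetric)
    (hH : ∀ᶠ τ in 𝓝[>] (0 : ℝ), ∀ v : Euc p, v ≠ 0 → 0 < inner ℝ v (Hnu M xs τ v)) :
    ∀ᶠ τ in 𝓝[>] (0 : ℝ), Real.exp (-((1 + L.lamTilde M xs τ (r τ)) /
      (4 * τ * trHnuInv M xs τ)) * (L.δ τ - L.bias M xs τ (r τ)) ^ 2)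
        * 2 ^ ((p : ℝ) / 2) ≤ 1 / 2 := by
  have hp' : (0 : ℝ) < p := by exact_mod_cast hp
  have h1 := h.tendsto_lower_sq.const_mul_atTop (by positivity : 0 < 1 / (4 * (p : ℝ)))
  have h2 := (Real.tendsto_exp_neg_atTop_nhds_zero.comp h1).mul_const ((2 : ℝ) ^ ((p : ℝ) / 2))
  rw [zero_mul] at h2
  filter_upwards [h2.eventually (gt_mem_nhds one_half_pos), h.eventually_trace_le hH, hH,
    self_mem_nhdsWithin, h.eventually_bias_le, h.delta.eventually_pos, h.lower]
    with τ h3 h4 h5 (h0 : 0 < τ) h6 h7 h8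
  refine le_trans ?_ h3.le
  have htr := trHnuInv_pos hp (hs τ) h5
  have hm := h8.1
  have l0 := lamTilde_nonneg (M := M) (xs := xs) h7.le (h.nonneg_r τ)
  have key : 1 / (4 * (p : ℝ)) * (m τ / τ * (L.δ τ / 2) ^ 2)
      ≤ (1 + L.lamTilde M xs τ (r τ)) / (4 * τ * trHnuInv M xs τ)
        * (L.δ τ - L.bias M xs τ (r τ)) ^ 2 :=
    calc _ = 1 / (4 * τ * (p / m τ)) * (L.δ τ / 2) ^ 2 := by field_simp
      _ ≤ _ := by gcongr <;> linarith
  simp only [Function.comp]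
  rw [neg_mul]
  exact mul_le_mul_of_nonneg_right (Real.exp_le_exp.2 (neg_le_neg key)) (by positivity)

end LocalData

/-! ### Ky Fan and Prokhorov distances. -/

section KyFan

variable {Ω W : Type*} [MeasurableSpace Ω] {P : Measure Ω} {d : W → W → ℝ} {ξ₁ ξ₂ : Ω → W}

theorem kyFan_nonneg : 0 ≤ kyFan P d ξ₁ ξ₂ := Real.sInf_nonneg fun _ h => h.1.le

/-- The infimum is attained up to replacing `<` by `≤`: the events for a sequence decreasing to `ρ`
increase to the event for `ρ`, and continuity from below passes the bound to the limit. -/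
theorem measure_kyFan_lt_le [IsProbabilityMeasure P] :
    P {ω | kyFan P d ξ₁ ξ₂ < d (ξ₁ ω) (ξ₂ ω)} ≤ ENNReal.ofReal (kyFan P d ξ₁ ξ₂) := by
  set ρ := kyFan P d ξ₁ ξ₂ with hρ
  have hne : {ε : ℝ | 0 < ε ∧ P {ω | ε < d (ξ₁ ω) (ξ₂ ω)} < ENNReal.ofReal ε}.Nonempty :=
    ⟨2, two_pos, prob_le_one.trans_lt (by simp)⟩
  have hgt : ∀ ε, ρ < ε → P {ω | ε < d (ξ₁ ω) (ξ₂ ω)} ≤ ENNReal.ofReal ε := fun ε hε => by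
    obtain ⟨ε', h1, h2⟩ := exists_lt_of_csInf_lt hne hε
    exact (measure_mono fun ω (hω : ε < _) => h2.trans hω).trans
      (h1.2.le.trans (ENNReal.ofReal_le_ofReal h2.le))
  obtain ⟨u, hu, hgtu, hlim⟩ := exists_seq_strictAnti_tendsto ρ
  have hU : {ω | ρ < d (ξ₁ ω) (ξ₂ ω)} = ⋃ k, {ω | u k < d (ξ₁ ω) (ξ₂ ω)} := by
    ext ω
    simp only [mem_ofPred_eq, mem_iUnion]
    refine ⟨fun h => (hlim.eventually (gt_mem_nhds h)).exists, ?_⟩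
    rintro ⟨k, hk⟩
    exact (hgtu k).trans hk
  have hmono : Monotone fun k => {ω | u k < d (ξ₁ ω) (ξ₂ ω)} := fun i j hij ω hω =>
    (hu.antitone hij).trans_lt hω
  rw [hU]
  have h1 := tendsto_measure_iUnion_atTop (μ := P) hmono
  have h2 := (ENNReal.continuous_ofReal.tendsto ρ).comp hlim
  exact le_of_tendsto_of_tendsto' h1 h2 fun k => hgt _ (hgtu k)

theorem kyFan_le_of_forall_gt {c : ℝ}
    (h : ∀ ε, 0 < ε → c < ε → P {ω | ε < d (ξ₁ ω) (ξ₂ ω)} < ENNReal.ofReal ε) (hc : 0 ≤ c) :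
    kyFan P d ξ₁ ξ₂ ≤ c := by
  refine le_of_forall_gt fun ε hε => ?_
  obtain ⟨ε', h1, h2⟩ := exists_between hε
  have h0 := hc.trans_lt h1
  have hbdd : BddBelow {ε : ℝ | 0 < ε ∧ P {ω | ε < d (ξ₁ ω) (ξ₂ ω)} < ENNReal.ofReal ε} :=
    ⟨0, fun _ h => h.1.le⟩
  exact (csInf_le hbdd ⟨h0, h ε' h0 h1⟩).trans_lt h2

/-- A set whose `η`-thickening contains `z` imposes no condition. Any other set stays at distance at
least `η > ε` from `z`, so its mass is part of the tail. -/
theorem levyProkhorovDist_dirac_le {E : Type*} [PseudoMetricSpace E] [MeasurableSpace E]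
    [OpensMeasurableSpace E] {μ : Measure E} [IsProbabilityMeasure μ] {z : E} {ε : ℝ} (hε : 0 ≤ ε)
    (h : μ {x | ε < dist x z} ≤ ENNReal.ofReal ε) :
    levyProkhorovDist μ (Measure.dirac z) ≤ ε := by
  refine levyProkhorovDist_le_of_forall_le _ _ hε fun η B hη hB => ?_
  by_cases hz : z ∈ Metric.thickening η B
  · refine prob_le_one.trans ?_
    rw [Measure.dirac_apply_of_mem hz]
    exact le_self_add
  · refine le_add_left ((measure_mono fun x hx => ?_).trans (h.trans
      (ENNReal.ofReal_le_ofReal hη.le)))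
    by_contra hx'
    refine hz (Metric.mem_thickening_iff.2 ⟨x, hx, ?_⟩)
    rw [dist_comm]
    exact (not_lt.1 hx').trans_lt hη

end KyFan

/-! ### From the ball to the whole posterior tail. -/

namespace GLIP

variable {n p : ℕ} (M : GLIP n p)

theorem isProbabilityMeasure_posterior {τ : ℝ} {y : Euc n} (hX : (interior M.X).Nonempty)
    (hint : IntegrableOn (fun x => Real.exp (-(M.h τ y x) / τ)) M.X) :
    IsProbabilityMeasure (M.posterior τ y) := by
  have : NeZero (volume.restrict M.X) := ⟨by
    rw [Ne, Measure.restrict_eq_zero]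
    exact ((isOpen_interior.measure_pos volume hX).trans_le
      (measure_mono interior_subset)).ne'⟩
  exact isProbabilityMeasure_tilted hint

/-- With masses `I` inside and `O = Δ₀ I` outside the ball, the tail is at most `(q I + O) / (I + O)
= (q + Δ₀) / (1 + Δ₀)`. -/
theorem posterior_tail_le {τ δ ε q : ℝ} {y : Euc n} {xs : Euc p} (hδ : 0 < δ)
    (hball : Metric.closedBall xs δ ⊆ M.X)
    (hint : IntegrableOn (fun x => Real.exp (-(M.h τ y x) / τ)) M.X)
    (hq : ∫ x in Metric.closedBall xs δ ∩ {x | ε < dist x xs},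
        Real.exp (-(M.h τ y x - M.h τ y xs) / τ)
      ≤ q * ∫ x in Metric.closedBall xs δ, Real.exp (-(M.h τ y x - M.h τ y xs) / τ)) :
    M.posterior τ y {x | ε < dist x xs}
      ≤ ENNReal.ofReal (1 - (1 - q) / (1 + M.Delta0 xs δ τ y)) := by
  set F : Euc p → ℝ := fun x => Real.exp (-(M.h τ y x - M.h τ y xs) / τ)
  have hF : ∀ x, Real.exp (-(M.h τ y x) / τ) = Real.exp (-(M.h τ y xs) / τ) * F x := fun x => by
    rw [← Real.exp_add]
    congr 1
    ring
  have hFi : IntegrableOn F M.X := by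
    have := hint.const_mul (Real.exp (-(M.h τ y xs) / τ))⁻¹
    refine this.congr (Eventually.of_forall fun x => ?_)
    simp only [hF x]
    rw [inv_mul_cancel_left₀ (Real.exp_pos _).ne']
  have hBm : MeasurableSet (Metric.closedBall xs δ) := Metric.isClosed_closedBall.measurableSet
  have hS : MeasurableSet {x : Euc p | ε < dist x xs} :=
    measurableSet_lt measurable_const (measurable_id.dist measurable_const)
  set I := ∫ x in Metric.closedBall xs δ, F x
  set O := ∫ x in M.X \ Metric.closedBall xs δ, F x
  have hD : M.Delta0 xs δ τ y = O / I := rfl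
  have hI : 0 < I := by
    refine (setIntegral_pos_iff_support_of_nonneg_ae (Eventually.of_forall fun x =>
      (Real.exp_pos _).le) (hFi.mono_set hball)).2 ?_
    have : Function.support F = univ := by
      ext x; simp [F, Real.exp_ne_zero]
    rw [this, univ_inter]
    exact Metric.measure_closedBall_pos volume xs hδ
  have hO : 0 ≤ O := integral_nonneg fun _ => (Real.exp_pos _).le
  have htot : ∫ x in M.X, F x = I + O := by
    have := integral_inter_add_sdiff hBm hFi
    rw [inter_eq_self_of_subset_right hball] at this
    exact this.symm
  have htail : ∫ x in {x : Euc p | ε < dist x xs} ∩ M.X, F x ≤ q * I + O := by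
    have h1 := integral_inter_add_sdiff (s := {x : Euc p | ε < dist x xs} ∩ M.X) hBm
      (hFi.mono_set inter_subset_right)
    rw [← h1]
    refine add_le_add ?_ ?_
    · have : {x : Euc p | ε < dist x xs} ∩ M.X ∩ Metric.closedBall xs δ
          = Metric.closedBall xs δ ∩ {x | ε < dist x xs} := by
        ext x
        have := @hball x
        simp only [mem_inter_iff]
        tauto
      rw [this]
      exact hq
    · refine setIntegral_mono_set (hFi.mono_set sdiff_subset)
        (Eventually.of_forall fun x => (Real.exp_pos _).le) (LE.le.eventuallyLE ?_)
      exact fun x hx => ⟨hx.1.2, hx.2⟩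
  rw [posterior, tilted_apply_eq_ofReal_integral' _ hS, Measure.restrict_restrict hS]
  refine ENNReal.ofReal_le_ofReal ?_
  have e : ∀ x, Real.exp (-(M.h τ y x) / τ) / ∫ x in M.X, Real.exp (-(M.h τ y x) / τ)
      = F x / (I + O) := fun x => by
    rw [hF x, funext hF, integral_const_mul, htot, mul_div_mul_left _ _ (Real.exp_pos _).ne']
  simp only [e]
  rw [integral_div, hD, div_le_iff₀ (by positivity)]
  refine htail.trans_eq ?_
  field_simp
  ring

end GLIP

/-- If `D + q ≤ T`, the tail, being at most `D + q`, is below `T`. Otherwise `D > s / 2`, so `q` is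
small relative to `D` and is absorbed by enlarging `D` by the factor `1 + 6 q / s`. -/
theorem one_sub_div_le_max {D₀ D q s T : ℝ} (hD₀ : 0 ≤ D₀) (hD : D₀ ≤ D) (hq0 : 0 ≤ q)
    (hq : q ≤ 1 / 2) (hs0 : 0 < s) (hs1 : s ≤ 1) (hqs : q ≤ s / 2) (hsT : s ≤ T) :
    1 - (1 - q) / (1 + D₀) ≤ max (D * (1 + 6 * q / s) / (1 + D * (1 + 6 * q / s))) T := by
  have hDn : 0 ≤ D := hD₀.trans hD
  have h1 : 1 - (1 - q) / (1 + D₀) ≤ 1 - (1 - q) / (1 + D) := by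
    gcongr
    linarith
  refine h1.trans ?_
  rcases le_or_gt D (T - q) with h | h
  · refine le_max_of_le_right ?_
    have : 1 - q - D ≤ (1 - q) / (1 + D) := by
      rw [le_div_iff₀ (by positivity)]
      nlinarith [mul_nonneg hq0 hDn]
    linarith
  · refine le_max_of_le_left ?_
    have hDs : s / 2 ≤ D := by linarith
    set w := 6 * q / s with hw
    have hw0 : 0 ≤ w := by positivity
    have hws : w * s = 6 * q := div_mul_cancel₀ _ hs0.ne'
    have hqw : 6 * q ≤ w := by nlinarith
    -- Weighting `D w ≥ 3 q` by `2 / 3` and `D w ≥ 6 q D` by `1 / 3` gives `D w ≥ 2 q (1 + D)`, and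
    -- `1 - q ≥ 1 / 2`; this explains the `6`.
    have key : q * (1 + D) ≤ (1 - q) * (D * w) := by
      have a1 : 3 * q ≤ D * w := by nlinarith
      have a2 : 6 * q * D ≤ D * w := by nlinarith
      have a3 : 0 ≤ D * w := by positivity
      nlinarith
    have e : D * (1 + w) / (1 + D * (1 + w)) = 1 - 1 / (1 + D * (1 + w)) := by
      field_simp
      ring
    rw [e]
    have : 1 / (1 + D * (1 + w)) ≤ (1 - q) / (1 + D) := by
      rw [div_le_div_iff₀ (by positivity) (by positivity)]
      linarith
    linarith

theorem inner_diagAbs_le {n : ℕ} (y z w : Euc n) :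
    inner ℝ w (LocalData.diagAbs y z w) ≤ ‖y - z‖ * ‖w‖ ^ 2 := by
  have e : inner ℝ w (LocalData.diagAbs y z w) = ∑ j, |y j - z j| * w j ^ 2 := by
    rw [PiLp.inner_apply]
    refine Finset.sum_congr rfl fun j _ => ?_
    simp [LocalData.diagAbs, Matrix.mulVec_diagonal]
    ring
  rw [e, EuclideanSpace.real_norm_sq_eq, Finset.mul_sum]
  refine Finset.sum_le_sum fun j _ => ?_
  gcongr
  exact PiLp.norm_apply_le (y - z) j

/-! ### Laplace approximation of the posterior on `B(xs, δ)`. -/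

namespace LocalData

variable {n p : ℕ} {L : LocalData n p} {M : GLIP n p} {xs : Euc p} {r : ℝ → ℝ}

theorem inner_hessVar {τ ρ : ℝ} (hS : L.Mf2sqrt.IsPositive) (v : Euc p) :
    inner ℝ v (L.hessVar M τ ρ v) = L.δ τ * ‖M.A‖ * inner ℝ (M.A v) (L.Cf τ (M.A v))
      + M.nu τ * (L.δ τ * inner ℝ v (L.Cg τ v)) + ρ * ‖L.Mf2sqrt (M.A v)‖ ^ 2 := by
  have h : inner ℝ (M.A v) (L.Mf2sqrt (L.Mf2sqrt (M.A v))) = ‖L.Mf2sqrt (M.A v)‖ ^ 2 := by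
    rw [← real_inner_self_eq_norm_sq]
    exact (hS.inner_left_eq_inner_right _ _).symm
  simp only [hessVar, D, Mf2, add_apply, smul_apply, inner_add_right, real_inner_smul_right,
    ContinuousLinearMap.comp_apply, ContinuousLinearMap.adjoint_inner_right, h]
  ring

/-- Moving from `xs` to `x` changes the Hessian by at most `δ D`; moving from `y*` to `y` changes it
by at most `r Aᵀ M_{f,2} A`, since `diag(|y_j - y*_j|) ≤ ‖y - y*‖`. -/
theorem eventually_hess_sub_Hnu_le (hsm : L.SmoothInX M xs r) (hcv : L.ConvergesInY M xs r)
    (hM : M.IsModel) :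
    ∀ᶠ τ in 𝓝[>] (0 : ℝ), ∀ y ∈ M.yLoc τ (r τ), ∀ x ∈ Metric.closedBall xs (L.δ τ), ∀ v,
      |inner ℝ (M.A v) (hess (M.f y) (M.A x) (M.A v)) + M.nu τ * inner ℝ v (hess M.g x v)
        - inner ℝ v (Hnu M xs τ v)| ≤ inner ℝ v (L.hessVar M τ (r τ) v) := by
  filter_upwards [hsm.hess_f, hsm.hess_g, hcv.hess_f, eventually_nu_pos hM]
    with τ h1 h2 h3 hν y hy x hx v
  have a1 := h1 y hy x hx (M.A v)
  have a2 := h2 x hx v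
  have a3 := h3 y hy (M.A v)
  have a4 : inner ℝ (M.A v) (L.Mf2sqrt (diagAbs y M.yexact (L.Mf2sqrt (M.A v))))
      ≤ r τ * ‖L.Mf2sqrt (M.A v)‖ ^ 2 := by
    have e := hcv.Mf2sqrt_pos.inner_left_eq_inner_right (M.A v)
      (diagAbs y M.yexact (L.Mf2sqrt (M.A v)))
    rw [← e]
    refine (inner_diagAbs_le _ _ _).trans ?_
    gcongr
    exact hy.2
  have a5 := mul_le_mul_of_nonneg_left a2 hν.le
  rw [← abs_of_pos hν, ← abs_mul, abs_of_pos hν] at a5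
  rw [inner_hessVar hcv.Mf2sqrt_pos, inner_Hnu]
  simp only [sub_apply, inner_sub_right] at a1 a3 a5
  rw [abs_le] at a1 a3 a5 ⊢
  constructor <;> linarith [a1.1, a1.2, a3.1, a3.2, a5.1, a5.2]

/-- Second-order expansion of `h_y` at `xs` in terms of `H_ν`. -/
theorem eventually_taylor (hsm : L.SmoothInX M xs r) (hcv : L.ConvergesInY M xs r)
    (hδ : L.DeltaAssumptions M xs r) (hM : M.IsModel) (hr : ∀ τ, 0 ≤ r τ)
    (hH : ∀ᶠ τ in 𝓝[>] (0 : ℝ), ∀ v : Euc p, v ≠ 0 → 0 < inner ℝ v (Hnu M xs τ v)) :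
    ∀ᶠ τ in 𝓝[>] (0 : ℝ), ∀ y ∈ M.yLoc τ (r τ), ∀ u ∈ Metric.closedBall (0 : Euc p) (L.δ τ),
      |M.h τ y (xs + u) - M.h τ y xs - inner ℝ (M.gradH τ y xs) u
        - 1 / 2 * inner ℝ u (Hnu M xs τ u)|
      ≤ 1 / 2 * (L.lamTilde M xs τ (r τ) * inner ℝ u (Hnu M xs τ u)) := by
  filter_upwards [hsm.contDiff_f, hsm.contDiff_g, eventually_hess_sub_Hnu_le hsm hcv hM, hH,
    hδ.eventually_pos, eventually_nu_pos hM] with τ h1 h2 h3 hpos hδ0 hν y hy u hu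
  refine (M.abs_h_sub_taylor_le (h1 y hy) h2 (h3 y hy) hu).trans ?_
  gcongr
  refine (inner_le_norm_inverse_comp_mul_inner
    (isSymmetric_Hnu hsm.contDiff_f_exact (hsm.contDiffAt_g hδ) τ) hpos
    (isPositive_hessVar (hsm.Cf_pos τ) (hsm.Cg_pos τ) hcv.Mf2sqrt_pos hδ0.le hν.le (hr τ))
    (HnuInv_Hnu hpos) u).trans ?_
  refine mul_le_mul_of_nonneg_right (norm_HnuInv_comp_hessVar_le hδ0.le (hr τ)) ?_
  rcases eq_or_ne u 0 with rfl | hu0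
  · simp
  · exact (hpos u hu0).le

/-- The Newton step at `xs` is bounded by the bias. -/
theorem eventually_norm_HnuInv_gradH_le (hM : M.IsModel) (hxs : M.IsLimitPoint xs)
    (hint : xs ∈ interior M.X) (hsm : L.SmoothInX M xs r) (hcv : L.ConvergesInY M xs r)
    (hl : ∀ᶠ τ in 𝓝[>] (0 : ℝ), L.lamTilde M xs τ (r τ) < 1) :
    ∀ᶠ τ in 𝓝[>] (0 : ℝ), ∀ y ∈ M.yLoc τ (r τ),
      ‖HnuInv M xs τ (M.gradH τ y xs)‖
        ≤ (1 - L.lamTilde M xs τ (r τ)) * L.bias M xs τ (r τ) := by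
  filter_upwards [hcv.grad, eventually_nu_pos hM, hl] with τ h1 hν hl y hy
  have e0 := hM.adjoint_gradient_eq_zero hxs.2.1 hint hsm.contDiff_f_exact
  have e : HnuInv M xs τ (M.gradH τ y xs) = (HnuInv M xs τ ∘L M.A.adjoint)
      (gradient (M.f y) (M.A xs) - gradient (M.f M.yexact) (M.A xs))
      + M.nu τ • HnuInv M xs τ (gradient M.g xs) := by
    simp [GLIP.gradH, map_sub, e0]
  have e2 : (1 - L.lamTilde M xs τ (r τ)) * L.bias M xs τ (r τ)
      = ‖HnuInv M xs τ ∘L M.A.adjoint ∘L L.Mf1‖ * r τ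
        + M.nu τ * ‖HnuInv M xs τ (gradient M.g xs)‖ := by
    have : 1 - L.lamTilde M xs τ (r τ) ≠ 0 := by linarith
    rw [bias, cbar1, cbar2]
    field_simp
  rw [e, e2]
  refine (norm_add_le _ _).trans (add_le_add ?_ ?_)
  · refine (h1 y hy _).trans ?_
    refine ((HnuInv M xs τ ∘L M.A.adjoint ∘L L.Mf1).le_opNorm (y - M.yexact)).trans ?_
    gcongr
    exact hy.2
  · rw [norm_smul, Real.norm_of_nonneg hν.le]

/-- The spread `√(-4 τ tr(H_ν⁻¹) log (4 τ tr(H_ν⁻¹)))`. -/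
def spread (M : GLIP n p) (xs : Euc p) (τ : ℝ) : ℝ :=
  Real.sqrt (-(4 * τ * trHnuInv M xs τ) * Real.log (4 * τ * trHnuInv M xs τ))

/-- A constant for the posterior tail inside the ball `B(xs, δ)`. -/
def tailConst (p : ℕ) : ℝ :=
  Real.exp 1 * 3 ^ ((p : ℝ) / 2) * (2 * 2 ^ ((p : ℝ) / 2))

theorem tailConst_pos (p : ℕ) : 0 < tailConst p := by unfold tailConst; positivity

theorem Orders.eventually_ball_tail_le {K : ℝ} {m : ℝ → ℝ} (h : Orders L M xs r K m) (hp : 0 < p)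
    (hM : M.IsModel) (hxs : M.IsLimitPoint xs) (hint : xs ∈ interior M.X)
    (hsm : L.SmoothInX M xs r) (hcv : L.ConvergesInY M xs r) (hproper : M.ProperPosterior)
    (hH : ∀ᶠ τ in 𝓝[>] (0 : ℝ), ∀ v : Euc p, v ≠ 0 → 0 < inner ℝ v (Hnu M xs τ v)) :
    ∀ᶠ τ in 𝓝[>] (0 : ℝ), ∀ y ∈ M.yLoc τ (r τ), ∀ ε,
      L.bias M xs τ (r τ) + spread M xs τ * (1 + L.DeltaStarK M xs τ (r τ)) ≤ ε →
      ∫ x in Metric.closedBall xs (L.δ τ) ∩ {x | ε < dist x xs},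
          Real.exp (-(M.h τ y x - M.h τ y xs) / τ)
        ≤ tailConst p * (4 * τ * trHnuInv M xs τ)
          * ∫ x in Metric.closedBall xs (L.δ τ), Real.exp (-(M.h τ y x - M.h τ y xs) / τ) := by
  have hs := isSymmetric_Hnu hsm.contDiff_f_exact (hsm.contDiffAt_g h.delta)
  have hlt : ∀ᶠ τ in 𝓝[>] (0 : ℝ), L.lamTilde M xs τ (r τ) < 1 := by
    filter_upwards [h.upper] with τ h1 using h1.2.2.2.1.trans_lt one_half_lt_one
  have hball : ∀ᶠ τ in 𝓝[>] (0 : ℝ), Metric.closedBall xs (L.δ τ) ⊆ M.X := by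
    obtain ⟨η, hη, hηX⟩ := Metric.nhds_basis_closedBall.mem_iff.1 (mem_interior_iff_mem_nhds.1 hint)
    filter_upwards [h.delta.tendsto_zero.eventually (gt_mem_nhds hη)] with τ hτ
    exact (Metric.closedBall_subset_closedBall hτ.le).trans hηX
  -- The factor `2 K` anticipates `⟨b, H b⟩ ≤ K β²` and `1 - l² ≥ 1 / 2` in the prefactor.
  have hprefac := h.tendsto_lamTilde_mul_bias_sq.const_mul (2 * K)
  rw [mul_zero] at hprefac
  filter_upwards [eventually_taylor hsm hcv h.delta hM h.nonneg_r hH,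
    eventually_norm_HnuInv_gradH_le hM hxs hint hsm hcv hlt, hball, hproper, hH, h.upper, h.lower,
    h.eventually_tail_le hp hs hH, h.eventually_bias_le, h.eventually_bias_nonneg,
    h.delta.eventually_pos, self_mem_nhdsWithin, h.eventually_lamTilde_le_DeltaStarK,
    hprefac.eventually (gt_mem_nhds one_pos),
    (h.tendsto_trace hs hH).eventually (gt_mem_nhds one_pos)]
    with τ htay hgrad hB hprop hpos hup hlow htail hbias hbias0 hδ0 (hτ : 0 < τ) hDS hpre hκ1
      y hy ε hε
  set l := L.lamTilde M xs τ (r τ)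
  set β := L.bias M xs τ (r τ)
  set T := trHnuInv M xs τ with hTdef
  set κ := 4 * τ * T with hκ
  set s := spread M xs τ
  set ΔK := L.DeltaStarK M xs τ (r τ)
  set b := HnuInv M xs τ (M.gradH τ y xs) with hb
  have hT : 0 < T := trHnuInv_pos hp (hs τ) hpos
  have hκ0 : 0 < κ := by positivity
  have hl0 : 0 ≤ l := lamTilde_nonneg hδ0.le (h.nonneg_r τ)
  have hl2 : l ≤ 1 / 2 := hup.2.2.2.1
  have hs0 : 0 ≤ s := Real.sqrt_nonneg _
  have hHb : Hnu M xs τ b = M.gradH τ y xs := Hnu_HnuInv hpos _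
  set φ : Euc p → ℝ := fun u => M.h τ y (xs + u) - M.h τ y xs
  have hpre1 : (fun u : Euc p => u + xs) ⁻¹' Metric.closedBall xs (L.δ τ)
      = Metric.closedBall 0 (L.δ τ) := by
    ext u; simp
  have hpre2 : (fun u : Euc p => u + xs) ⁻¹' (Metric.closedBall xs (L.δ τ) ∩ {x | ε < dist x xs})
      = Metric.closedBall 0 (L.δ τ) ∩ {u | ε < ‖u‖} := by
    ext u; simp [dist_eq_norm]
  have hint1 : ∀ S : Set (Euc p), ∫ x in S, Real.exp (-(M.h τ y x - M.h τ y xs) / τ)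
      = ∫ u in (fun u => u + xs) ⁻¹' S, Real.exp (-φ u / τ) := fun S => by
    rw [← setIntegral_comp_add_right (fun x => Real.exp (-(M.h τ y x - M.h τ y xs) / τ)) xs S]
    simp only [φ, add_comm xs]
  have hφi : IntegrableOn (fun u => Real.exp (-φ u / τ)) (Metric.closedBall 0 (L.δ τ)) := by
    have h1 : IntegrableOn (fun x => Real.exp (-(M.h τ y x - M.h τ y xs) / τ))
        (Metric.closedBall xs (L.δ τ)) := by
      refine (((hprop y hy.1).mono_set hB).const_mul (Real.exp (M.h τ y xs / τ))).congr
        (Eventually.of_forall fun x => ?_)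
      simp only
      rw [← Real.exp_add]
      congr 1
      ring
    have h2 := ((measurePreserving_add_right (volume : Measure (Euc p)) xs).integrableOn_comp_preimage
      (measurableEmbedding_addRight xs)).2 h1
    rw [hpre1] at h2
    refine h2.congr (Eventually.of_forall fun u => ?_)
    simp [φ, add_comm]
  have main := setIntegral_ball_tail_le (hs τ) hlow.1 hlow.2 hT
    (sq_norm_le_trace_mul_inner (hs τ) hpos (HnuInv_Hnu hpos)) hτ hl0 (by linarith)
    (hgrad y hy) (by linarith : β ≤ L.δ τ)
    (mul_nonneg hs0 (by linarith : (0 : ℝ) ≤ 1 + ΔK)) hε hφi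
    (fun u hu => by
      have := (abs_le.1 (htay y hy u hu)).1
      rw [← hb, hHb]
      simp only [φ]
      linarith)
    (fun u hu => by
      have := (abs_le.1 (htay y hy u hu)).2
      rw [← hb, hHb]
      simp only [φ]
      linarith)
    (by rw [finrank_euclideanSpace_fin]; exact htail)
  rw [hint1, hint1, hpre1, hpre2]
  refine main.trans (mul_le_mul_of_nonneg_right ?_ (integral_nonneg fun _ => (Real.exp_pos _).le))
  rw [finrank_euclideanSpace_fin, tailConst]
  have g1 : inner ℝ b (Hnu M xs τ b) * l / (τ * (1 - l ^ 2)) ≤ 1 := by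
    have hb2 : ‖b‖ ≤ β := (hgrad y hy).trans (by nlinarith)
    have i1 : inner ℝ b (Hnu M xs τ b) ≤ K * β ^ 2 := by
      calc _ ≤ ‖b‖ * (‖Hnu M xs τ‖ * ‖b‖) := (real_inner_le_norm _ _).trans
            (mul_le_mul_of_nonneg_left ((Hnu M xs τ).le_opNorm b) (norm_nonneg _))
        _ ≤ β * (K * β) := by
          have := hup.2.1
          have := h.K_pos.le
          gcongr
        _ = _ := by ring
    rw [← mul_div_assoc, div_lt_one hτ] at hpre
    have hll : 1 / 2 ≤ 1 - l ^ 2 := by nlinarith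
    rw [div_le_one (by positivity)]
    calc _ ≤ K * β ^ 2 * l := by gcongr
      _ ≤ τ * (1 / 2) := by linarith
      _ ≤ _ := by gcongr
  have g2 : (1 + l) / (1 - l) ≤ 3 := by
    rw [div_le_iff₀ (by linarith)]
    linarith
  -- The spread is chosen so that `exp (-s² / κ) = κ`. The factor `1 - l` is compensated by `(1 +
  -- ΔK)² ≥ (1 + l)²`, because `(1 - l) (1 + l)² ≥ 1` for `0 ≤ l ≤ 1 / 2`.
  have g3 : Real.exp (-((1 - l) / (4 * τ * T)) * (s * (1 + ΔK)) ^ 2) ≤ κ := by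
    rw [← hκ, ← Real.le_log_iff_exp_le hκ0]
    have hs2 : s ^ 2 = -κ * Real.log κ := Real.sq_sqrt
      (mul_nonneg_of_nonpos_of_nonpos (by linarith) (Real.log_nonpos hκ0.le hκ1.le))
    have i1 : 1 ≤ (1 - l) * (1 + ΔK) ^ 2 := by
      have : (1 + l) ^ 2 ≤ (1 + ΔK) ^ 2 := by gcongr
      nlinarith
    have i2 : s ^ 2 ≤ (1 - l) * (1 + ΔK) ^ 2 * s ^ 2 := le_mul_of_one_le_left (sq_nonneg s) i1
    have i3 : -((1 - l) / κ) * (s * (1 + ΔK)) ^ 2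
        = -((1 - l) * (1 + ΔK) ^ 2 * s ^ 2) / κ := by ring
    rw [i3, div_le_iff₀ hκ0]
    linarith
  have hl1 : 0 < 1 - l := by linarith
  gcongr

end LocalData

/-! ### Concentration of the posterior and conclusion. -/

namespace LocalData

variable {n p : ℕ} {L : LocalData n p} {M : GLIP n p} {xs : Euc p} {r : ℝ → ℝ}

theorem sqrt_le_sqrt_neg_mul_log {κ : ℝ} (h0 : 0 ≤ κ) (h1 : κ ≤ Real.exp (-1)) :
    Real.sqrt κ ≤ Real.sqrt (-κ * Real.log κ) := by
  refine Real.sqrt_le_sqrt ?_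
  rcases h0.eq_or_lt with rfl | h0
  · simp
  · have := (Real.log_le_iff_le_exp h0).2 h1
    nlinarith

/-- For small `κ` one has `-log κ ≥ 1`, so the spread is at least `√κ`, and the tail `O(κ)` inside
the ball is `o(s)`. The first limit is the relative correction of `Δ₀`. -/
theorem Orders.exists_Delta0_correction {K : ℝ} {m : ℝ → ℝ} (h : Orders L M xs r K m)
    (hs : ∀ τ, (Hnu M xs τ).IsSymmetric)
    (hH : ∀ᶠ τ in 𝓝[>] (0 : ℝ), ∀ v : Euc p, v ≠ 0 → 0 < inner ℝ v (Hnu M xs τ v)) :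
    Tendsto (fun τ => 6 * (tailConst p * (4 * τ * trHnuInv M xs τ)) / spread M xs τ)
      (𝓝[>] 0) (𝓝 0) ∧ ∀ᶠ τ in 𝓝[>] (0 : ℝ), spread M xs τ ≤ 1 ∧
        tailConst p * (4 * τ * trHnuInv M xs τ) ≤ spread M xs τ / 2 ∧
        Real.sqrt (4 * τ * trHnuInv M xs τ) ≤ spread M xs τ := by
  have hκ := h.tendsto_trace hs hH
  have hC := tailConst_pos p
  have hκ0 : ∀ᶠ τ in 𝓝[>] (0 : ℝ), 0 ≤ 4 * τ * trHnuInv M xs τ := by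
    filter_upwards [hH, self_mem_nhdsWithin] with τ h2 (h0 : 0 < τ)
    have := trHnuInv_nonneg (hs τ) h2
    positivity
  have hsq : Tendsto (fun τ => Real.sqrt (4 * τ * trHnuInv M xs τ)) (𝓝[>] 0) (𝓝 0) := by
    simpa using hκ.sqrt
  have hle : ∀ᶠ τ in 𝓝[>] (0 : ℝ), Real.sqrt (4 * τ * trHnuInv M xs τ) ≤ spread M xs τ := by
    filter_upwards [hκ0, hκ.eventually (gt_mem_nhds (Real.exp_pos (-1)))] with τ h1 h2
    exact sqrt_le_sqrt_neg_mul_log h1 h2.le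
  have hspread : Tendsto (spread M xs) (𝓝[>] 0) (𝓝 0) := by
    have := ((Real.continuous_negMulLog.tendsto 0).comp hκ).sqrt
    rw [Real.negMulLog_zero, Real.sqrt_zero] at this
    exact this
  constructor
  · have hlim := hsq.const_mul (6 * tailConst p)
    rw [mul_zero] at hlim
    refine tendsto_of_tendsto_of_tendsto_of_le_of_le' tendsto_const_nhds hlim ?_ ?_
    · filter_upwards [hκ0] with τ h1
      exact div_nonneg (by positivity) (Real.sqrt_nonneg _)
    · filter_upwards [hκ0, hle] with τ h1 h2
      refine div_le_of_le_mul₀ (Real.sqrt_nonneg _) (by positivity) ?_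
      calc _ = 6 * tailConst p * (√(4 * τ * trHnuInv M xs τ) * √(4 * τ * trHnuInv M xs τ)) := by
            rw [Real.mul_self_sqrt h1]; ring
        _ ≤ 6 * tailConst p * (√(4 * τ * trHnuInv M xs τ) * spread M xs τ) := by gcongr
        _ = _ := by ring
  · have hlim := hsq.const_mul (tailConst p)
    rw [mul_zero] at hlim
    filter_upwards [hκ0, hle, hspread.eventually (gt_mem_nhds one_pos),
      hlim.eventually (gt_mem_nhds one_half_pos)] with τ h1 h2 h3 h4
    refine ⟨h3.le, ?_, h2⟩
    calc _ = tailConst p * √(4 * τ * trHnuInv M xs τ) * √(4 * τ * trHnuInv M xs τ) := by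
          rw [mul_assoc (tailConst p) √_ √_, Real.mul_self_sqrt h1]
      _ ≤ 1 / 2 * spread M xs τ := by gcongr
      _ = _ := by ring

/-- Concentration of the posterior distribution, uniformly for the data in `yLoc`. -/
theorem Orders.eventually_levyProkhorovDist_le {K : ℝ} {m : ℝ → ℝ} (h : Orders L M xs r K m)
    (hM : M.IsModel) (hxs : M.IsLimitPoint xs) (hint : xs ∈ interior M.X)
    (hsm : L.SmoothInX M xs r) (hcv : L.ConvergesInY M xs r) (hproper : M.ProperPosterior)
    (hH : ∀ᶠ τ in 𝓝[>] (0 : ℝ), ∀ v : Euc p, v ≠ 0 → 0 < inner ℝ v (Hnu M xs τ v))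
    {Δ₀ : ℝ → ℝ} (hΔ₀ : ∀ τ, Δ₀ τ = M.Delta0Sup xs (L.δ τ) τ (r τ)
      * (1 + 6 * (tailConst p * (4 * τ * trHnuInv M xs τ)) / spread M xs τ)) :
    ∀ᶠ τ in 𝓝[>] (0 : ℝ), ∀ y ∈ M.yLoc τ (r τ), ∀ ε, 0 < ε →
      max (Δ₀ τ / (1 + Δ₀ τ))
        (L.bias M xs τ (r τ) + spread M xs τ * (1 + L.DeltaStarK M xs τ (r τ))) < ε →
      levyProkhorovDist (M.posterior τ y) (Measure.dirac xs) ≤ ε := by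
  have hs := isSymmetric_Hnu hsm.contDiff_f_exact (hsm.contDiffAt_g h.delta)
  -- In dimension zero the trace and the spread vanish, so the general argument, which divides by
  -- them, is unavailable; but there the tail is empty.
  rcases Nat.eq_zero_or_pos p with rfl | hp
  · filter_upwards [hproper] with τ h1 y hy ε hε _
    have := M.isProbabilityMeasure_posterior ⟨xs, hint⟩ (h1 y hy.1)
    refine levyProkhorovDist_dirac_le hε.le ?_
    have e : {x : Euc 0 | ε < dist x xs} = ∅ := by
      ext x
      simp [Subsingleton.elim x xs, hε.le]
    simp [e]
  have hball : ∀ᶠ τ in 𝓝[>] (0 : ℝ), Metric.closedBall xs (L.δ τ) ⊆ M.X := by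
    obtain ⟨η, hη, hηX⟩ := Metric.nhds_basis_closedBall.mem_iff.1 (mem_interior_iff_mem_nhds.1 hint)
    filter_upwards [h.delta.tendsto_zero.eventually (gt_mem_nhds hη)] with τ hτ
    exact (Metric.closedBall_subset_closedBall hτ.le).trans hηX
  filter_upwards [hproper, h.eventually_ball_tail_le hp hM hxs hint hsm hcv hproper hH,
    (h.exists_Delta0_correction hs hH).2, hball, hH, h.delta.eventually_pos, self_mem_nhdsWithin,
    h.delta.eventually_Delta0_le, h.eventually_bias_nonneg, h.eventually_lamTilde_le_DeltaStarK]
    with τ h1 htail ⟨hs1, hqs, hκs⟩ hB hpos hδ0 (hτ : 0 < τ) hD hb hDS y hy ε hε hlt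
  have := M.isProbabilityMeasure_posterior ⟨xs, hint⟩ (h1 y hy.1)
  refine levyProkhorovDist_dirac_le hε.le ?_
  have hT : 0 < trHnuInv M xs τ := trHnuInv_pos hp (hs τ) hpos
  have hκ : 0 < 4 * τ * trHnuInv M xs τ := by positivity
  have hs0 : 0 < spread M xs τ := (Real.sqrt_pos.2 hκ).trans_le hκs
  have hC := tailConst_pos p
  have hl0 := lamTilde_nonneg (M := M) (xs := xs) hδ0.le (h.nonneg_r τ)
  refine (M.posterior_tail_le hδ0 hB (h1 y hy.1)
    (htail y hy ε ((le_max_right _ _).trans hlt.le))).trans (ENNReal.ofReal_le_ofReal ?_)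
  rw [hΔ₀] at hlt
  refine (one_sub_div_le_max (M.Delta0_nonneg _ _ _ _) (hD y hy) (by positivity) (by linarith)
    hs0 hs1 hqs ?_).trans hlt.le
  nlinarith

end LocalData

namespace GLIP

variable {n p : ℕ} {M : GLIP n p}

theorem ae_mem_Ysp {Ω : Type*} [MeasurableSpace Ω] {P : Measure Ω} (hM : M.IsModel) {τ : ℝ}
    {Y : Ω → Euc n} (hY : HasLaw Y (M.likelihood τ M.xtrue) P) : ∀ᵐ ω ∂P, Y ω ∈ M.Ysp τ := by
  refine ae_of_ae_map hY.aemeasurable ?_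
  rw [hY.map_eq]
  exact (withDensity_absolutelyContinuous _ _).ae_le (ae_restrict_mem (hM.measurableSet_Ysp τ))

end GLIP

theorem mainTheorem1 {n p : ℕ} {Ω : Type*} [MeasurableSpace Ω] (P : Measure Ω)
    [IsProbabilityMeasure P]
    -- the Bayesian model, with data `Y τ` drawn from the likelihood at `xtrue`
    (M : GLIP n p) (hM : M.IsModel)
    (Y : ℝ → Ω → Euc n)
    (hY : ∀ τ, 0 < τ → HasLaw (Y τ) (M.likelihood τ M.xtrue) P)
    (hYlim : TendstoInMeasure P Y (𝓝[>] (0 : ℝ)) (fun _ => M.yexact))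
    (hproper : M.ProperPosterior)
    -- the point of concentration, interior to `X`
    (xs : Euc p) (hxs : M.IsLimitPoint xs) (hint : xs ∈ interior M.X)
    -- `r τ` is the Ky Fan distance between the data and the exact data
    (r : ℝ → ℝ) (hr : ∀ τ, r τ = kyFan P dist (Y τ) (fun _ => M.yexact))
    -- smoothness, convergence and `δ` assumptions
    (L : LocalData n p) (hsmooth : L.SmoothInX M xs r) (hconv : L.ConvergesInY M xs r)
    (hδ : L.DeltaAssumptions M xs r)
    -- nondegeneracy of the likelihood Hessian on the range of `A`, and of `H_ν`
    (hV : ∀ v : Euc p, M.A v ≠ 0 →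
      0 < inner ℝ (M.A v) (hess (M.f M.yexact) (M.A xs) (M.A v)))
    (hH : ∀ᶠ τ in 𝓝[>] (0 : ℝ), ∀ v : Euc p, v ≠ 0 →
      0 < inner ℝ v (LocalData.Hnu M xs τ v)) :
    ∃ Δ₀ : ℝ → ℝ,
      (∃ w : ℝ → ℝ, Tendsto w (𝓝[>] 0) (𝓝 0) ∧
        ∀ τ, Δ₀ τ = M.Delta0Sup xs (L.δ τ) τ (r τ) * (1 + w τ)) ∧
      (∃ τ₀ : ℝ, 0 < τ₀ ∧ ∀ τ, 0 < τ → τ ≤ τ₀ →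
        L.lamTilde M xs τ (r τ) < 1 ∧
        4 * τ * LocalData.trHnuInv M xs τ < 1 ∧
        kyFan P levyProkhorovDist (fun ω => M.posterior τ (Y τ ω)) (fun _ => Measure.dirac xs) ≤
          max (2 * r τ) (max (Δ₀ τ / (1 + Δ₀ τ))
            (L.cbar1 M xs τ (r τ) * r τ + L.cbar2 M xs τ (r τ) * M.nu τ
              + Real.sqrt (-(4 * τ * LocalData.trHnuInv M xs τ)
                  * Real.log (4 * τ * LocalData.trHnuInv M xs τ))
                * (1 + L.DeltaStarK M xs τ (r τ))))) ∧
      Tendsto (fun τ => L.DeltaStarK M xs τ (r τ)) (𝓝[>] 0) (𝓝 0) := by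
  have hr0 : ∀ τ, 0 ≤ r τ := fun τ => by rw [hr]; exact kyFan_nonneg
  obtain ⟨K, hK, hup⟩ := LocalData.exists_bounds hM hr0 hxs hint hsmooth hδ hV hH
  obtain ⟨m, hlow, hlim⟩ := LocalData.exists_lowerBound_Hnu hM hr0 hδ hV hH
  have h : LocalData.Orders L M xs r K m := ⟨hK, hup, hlow, hlim, hr0, hδ,
    LocalData.eventually_nu_pos hM, hδ.tendsto_r hM hr0⟩
  have hs := LocalData.isSymmetric_Hnu hsmooth.contDiff_f_exact (hsmooth.contDiffAt_g hδ)
  refine ⟨fun τ => M.Delta0Sup xs (L.δ τ) τ (r τ) * (1 + 6 * (LocalData.tailConst p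
      * (4 * τ * LocalData.trHnuInv M xs τ)) / LocalData.spread M xs τ),
    ⟨_, (h.exists_Delta0_correction hs hH).1, fun _ => rfl⟩, ?_, h.tendsto_DeltaStarK⟩
  have hev := h.eventually_levyProkhorovDist_le hM hxs hint hsmooth hconv hproper hH
    (fun τ => rfl)
  have hlam : ∀ᶠ τ in 𝓝[>] (0 : ℝ), L.lamTilde M xs τ (r τ) < 1 :=
    h.tendsto_lamTilde.eventually (gt_mem_nhds one_pos)
  have htr : ∀ᶠ τ in 𝓝[>] (0 : ℝ), 4 * τ * LocalData.trHnuInv M xs τ < 1 :=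
    (h.tendsto_trace hs hH).eventually (gt_mem_nhds one_pos)
  obtain ⟨τ₀, hτ₀, hsub⟩ := mem_nhdsGT_iff_exists_Ioc_subset.1 ((hev.and hlam).and htr)
  refine ⟨τ₀, hτ₀, fun τ hτ hττ₀ => ?_⟩
  obtain ⟨⟨hconc, h1⟩, h2⟩ := hsub ⟨hτ, hττ₀⟩
  refine ⟨h1, h2, kyFan_le_of_forall_gt (fun ε hε hlt => ?_)
    (le_max_of_le_left (by linarith [hr0 τ]))⟩
  have hrε : r τ < ε := by
    have := (le_max_left _ _).trans_lt hlt
    linarith [hr0 τ]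
  -- Almost surely the data lie in the sample space, so outside the event on the right they belong
  -- to `yLoc`, where the Prokhorov distance is at most `ε`.
  calc _ ≤ P {ω | r τ < dist (Y τ ω) M.yexact} := by
        refine measure_mono_ae ?_
        filter_upwards [GLIP.ae_mem_Ysp hM (hY τ hτ)] with ω hω hωε
        by_contra hle
        have hle' : dist (Y τ ω) M.yexact ≤ r τ := not_lt.1 hle
        rw [dist_eq_norm] at hle'
        exact not_lt.2 (hconc (Y τ ω) ⟨hω, hle'⟩ ε hε ((le_max_right _ _).trans_lt hlt)) hωε
    _ ≤ ENNReal.ofReal (r τ) := by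
        rw [hr τ]
        exact measure_kyFan_lt_le
    _ < ENNReal.ofReal ε := (ENNReal.ofReal_lt_ofReal_iff hε).2 hrε

end
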